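/- All hypergraphs are finite and have no repeated hyperedges. Let $k\ge 3$, $m\ge 3$ and $0<\alpha<1$. A hypergraph is $k$-uniform if every hyperedge has exactly $k$ vertices, linear if any two distinct hyperedges share at most one vertex, and unicyclic if it is connected and contains exactly one cycle (a cycle is an alternating cyclic sequence $v_1e_1v_2e_2\cdots v_\ell e_\ell v_1$, $\ell\ge 2$, of distinct vertices and distinct hyperedges with $v_i,v_{i+1}\in e_i$; starting point and direction are disregarded). The $k$-uniform hypercycle $C_m^{(k)}$ has vertices $u_i$ and $w_{i,j}$ ($i\in\mathbb{Z}/m$, $1\le j\le k-2$), all distinct, and hyperedges $e_i=\{u_i,w_{i,1},\dots,w_{i,k-2},u_{i+1}\}$, $i\in\mathbb{Z}/m$. For a $k$-uniform hypergraph $\mathcal H$ on $n$ vertices put $\mathcal A_\alpha(\mathcal H)=\alpha\mathcal D(\mathcal H)+(1-\alpha)\mathcal A(\mathcal H)$, where $\mathcal D(\mathcal H)$ is the order-$k$ diagonal tensor of vertex degrees and $\mathcal A(\mathcal H)$ is the adjacency tensor, with entry $\frac1{(k-1)!}$ at $(i_1,\dots,i_k)$ if $\{i_1,\dots,i_k\}$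 is a hyperedge and $0$ otherwise. The $d$-th order trace of an order-$k$, $n$-dimensional tensor $\mathcal T$ is $$\mathrm{Tr}_d(\mathcal T)=(k-1)^{n-1}\sum_{d_1+\cdots+d_n=d}\ \prod_{i=1}^n\frac{1}{(d_i(k-1))!}\Bigl(\sum_{(i_2,\dots,i_k)\in[n]^{k-1}}\mathcal T_{i i_2\cdots i_k}\frac{\partial}{\partial a_{ii_2}}\cdots\frac{\partial}{\partial a_{ii_k}}\Bigr)^{d_i}\mathrm{tr}\bigl(A^{d(k-1)}\bigr),$$ where the $d_i$ are nonnegative integers and $A=(a_{ij})$ is an $n\times n$ matrix of variables. For $k$-uniform hypergraphs $\mathcal H_1,\mathcal H_2$ with the same number $n$ of vertices, write $\mathcal H_1\prec_\alpha\mathcal H_2$ if there is an integer $d$ with $1\le d\le n(k-1)^{n-1}-1$ such that $\mathrm{Tr}_t(\mathcal A_\alpha(\mathcal H_1))=\mathrm{Tr}_t(\mathcal A_\alpha(\mathcal H_2))$ for $0\le t<d$ and $\mathrm{Tr}_d(\mathcal A_\alpha(\mathcal H_1))<\mathrm{Tr}_d(\mathcal A_\alpha(\mathcal H_2))$; write $\mathcal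 H_1=_\alpha\mathcal H_2$ if these traces agree for all $0\le t\le n(k-1)^{n-1}-1$; and write $\mathcal H_1\preceq_\alpha\mathcal H_2$ if $\mathcal H_1\prec_\alpha\mathcal H_2$ or $\mathcal H_1=_\alpha\mathcal H_2$. **Theorem.** The hypercycle $C_m^{(k)}$ is the first hypergraph in $S_\alpha$-order among all $k$-uniform linear unicyclic hypergraphs with $m$ hyperedges. That is, $C_m^{(k)}$ is a $k$-uniform linear unicyclic hypergraph with $m$ hyperedges, and every $k$-uniform linear unicyclic hypergraph $\mathcal H$ with $m$ hyperedges has the same number of vertices as $C_m^{(k)}$ and satisfies $C_m^{(k)}\preceq_\alpha\mathcal H$, with $C_m^{(k)}=_\alpha\mathcal H$ if and only if $\mathcal H$ is isomorphic to $C_m^{(k)}$. -/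

import Mathlib

open scoped Nat

/-! ### Tensors and their traces -/

/-- Real tensors of order `k` with index set `ι`. The entry with indices `i, i₂, …, i_k` is written
`T i a`, where `a = (i₂, …, i_k)`. -/
abbrev RTensor (ι : Type*) (k : ℕ) : Type _ := ι → (Fin (k - 1) → ι) → ℝ

namespace RTensor

variable {ι : Type*}

/-- The partial derivative `∂/∂a_{ij}` acting on polynomials in the entries of an auxiliary
matrix `(a_{ij})`. -/
noncomputable def partialD (i j : ι) : Module.End ℝ (MvPolynomial (ι × ι) ℝ) :=
  (MvPolynomial.pderiv (i, j)).toLinearMap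

theorem partialD_commute (i j i' j' : ι) : Commute (partialD i j) (partialD i' j') := by
  have h : ⁅MvPolynomial.pderiv (R := ℝ) (i, j), MvPolynomial.pderiv (R := ℝ) (i', j')⁆ = 0 := by
    classical
    refine MvPolynomial.derivation_ext fun x => ?_
    simp [Derivation.commutator_apply, MvPolynomial.pderiv_X, Pi.single_apply, apply_ite]
  refine LinearMap.ext fun p => ?_
  have := congrArg (fun D => D p) h
  simpa [partialD, Derivation.commutator_apply, sub_eq_zero] using this

/-- `∂/∂a_{i a} = ∂/∂a_{i i₂} ⋯ ∂/∂a_{i i_k}` for `a = (i₂, …, i_k)`. -/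
noncomputable def multiPartial {k : ℕ} (i : ι) (a : Fin (k - 1) → ι) :
    Module.End ℝ (MvPolynomial (ι × ι) ℝ) :=
  Finset.univ.noncommProd (fun j => partialD i (a j))
    (fun _ _ _ _ _ => partialD_commute _ _ _ _)

theorem multiPartial_commute {k : ℕ} (i i' : ι) (a a' : Fin (k - 1) → ι) :
    Commute (multiPartial i a) (multiPartial i' a') :=
  Finset.noncommProd_commute _ _ _ _ fun _ _ =>
    (Finset.noncommProd_commute _ _ _ _ fun _ _ => partialD_commute _ _ _ _).symm

variable [Fintype ι] {k : ℕ}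

/-- The operator `∑_a T_{i a} ∂/∂a_{i a}`, the sum over all `a ∈ ι ^ (k - 1)`. -/
noncomputable def rowOperator (T : RTensor ι k) (i : ι) :
    Module.End ℝ (MvPolynomial (ι × ι) ℝ) :=
  ∑ a : Fin (k - 1) → ι, T i a • multiPartial i a

theorem rowOperator_commute (T : RTensor ι k) (i i' : ι) :
    Commute (rowOperator T i) (rowOperator T i') :=
  Commute.sum_left _ _ _ fun _ _ => Commute.sum_right _ _ _ fun _ _ =>
    ((multiPartial_commute _ _ _ _).smul_left _).smul_right _

variable [DecidableEq ι]

/-- The polynomial `tr (A ^ N)`, where `A = (a_{ij})` is the auxiliary matrix of variables. -/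
noncomputable def auxTrace (ι : Type*) [Fintype ι] [DecidableEq ι] (N : ℕ) :
    MvPolynomial (ι × ι) ℝ :=
  (Matrix.mvPolynomialX ι ι ℝ ^ N).trace

/-- The `d`-th order trace of a tensor of order `k` and dimension `n`,
`(k-1)^(n-1) ∑_{d₁+⋯+d_n=d} ∏_i (1/(d_i(k-1))!) (∑_a T_{i a} ∂/∂a_{i a})^{d_i} tr (A^{d(k-1)})`.
The operators are homogeneous of total order `d (k - 1)`, so the result is a constant polynomial;
`MvPolynomial.constantCoeff` reads it as a real number. -/
noncomputable def trace (T : RTensor ι k) (d : ℕ) : ℝ :=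
  ((k : ℝ) - 1) ^ (Fintype.card ι - 1) *
    ∑ D ∈ Finset.piAntidiag (Finset.univ : Finset ι) d,
      (∏ i, (1 / ((D i * (k - 1))! : ℝ))) *
        MvPolynomial.constantCoeff
          (Finset.univ.noncommProd (fun i => rowOperator T i ^ D i)
            (fun _ _ _ _ _ => (rowOperator_commute T _ _).pow_pow _ _)
            (auxTrace ι (d * (k - 1))))

end RTensor

/-! ### Hypergraphs -/

namespace Hypergraph

variable {β β₁ β₂ : Type*}

/-- Every hyperedge has exactly `k` vertices. -/
def IsUniform (H : Hypergraph β) (k : ℕ) : Prop := ∀ e ∈ H.edgeSet, e.ncard = k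

/-- Two different hyperedges have at most one common vertex. -/
def IsLinear (H : Hypergraph β) : Prop :=
  ∀ e ∈ H.edgeSet, ∀ f ∈ H.edgeSet, e ≠ f → (e ∩ f).Subsingleton

/-- The bipartite incidence graph: `v` and `e` are adjacent when `v ∈ e`. -/
def incidenceGraph (H : Hypergraph β) : SimpleGraph (H.vertexSet ⊕ H.edgeSet) :=
  SimpleGraph.fromRel fun x y =>
    ∃ (v : H.vertexSet) (e : H.edgeSet), x = Sum.inl v ∧ y = Sum.inr e ∧ (v : β) ∈ (e : Set β)

/-- A hypergraph is connected if it has a vertex and any two of its vertices are joined by a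
sequence `v₀ e₁ v₁ e₂ ⋯ e_l v_l` with `v_{i-1}, v_i ∈ e_i`. -/
def IsConnected (H : Hypergraph β) : Prop :=
  H.vertexSet.Nonempty ∧
    ∀ u v : H.vertexSet, H.incidenceGraph.Reachable (Sum.inl u) (Sum.inl v)

/-- Connected with exactly one cycle. A cycle `v₁ e₁ v₂ e₂ ⋯ v_l e_l v₁` of a hypergraph (`l ≥ 2`,
distinct vertices, distinct hyperedges, `v_i, v_{i+1} ∈ e_i`) is a cycle of its incidence graph;
passing to the subgraph identifies cycles that differ by the starting point or the direction. -/
def IsUnicyclic (H : Hypergraph β) : Prop :=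
  H.IsConnected ∧
    ∃! C : H.incidenceGraph.Subgraph,
      ∃ (x : H.vertexSet ⊕ H.edgeSet) (c : H.incidenceGraph.Walk x x),
        c.IsCycle ∧ c.toSubgraph = C

/-- `k`-uniform linear unicyclic hypergraphs with `m` hyperedges. -/
structure IsLinearUnicyclic (H : Hypergraph β) (k m : ℕ) : Prop where
  uniform : H.IsUniform k
  linear : H.IsLinear
  unicyclic : H.IsUnicyclic
  ncard_edgeSet : H.edgeSet.ncard = m

/-- Isomorphism of hypergraphs: a bijection of the vertex sets that carries hyperedges to hyperedges
in both directions. -/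
def IsIsomorphic (H₁ : Hypergraph β₁) (H₂ : Hypergraph β₂) : Prop :=
  ∃ ψ : H₁.vertexSet ≃ H₂.vertexSet, ∀ e : Set H₁.vertexSet,
    Subtype.val '' e ∈ H₁.edgeSet ↔ Subtype.val '' (ψ '' e) ∈ H₂.edgeSet

/-- The `k`-uniform hypercycle with `m` hyperedges (`k ≥ 2`, `m ≥ 3`). The vertices are
`u_i = inl i` and `w_{i,j} = inr (i, j)`, where `i` is taken modulo `m` and `j` runs over `k - 2`
values; the hyperedges are `e_i = {u_i, u_{i+1}} ∪ {w_{i,j} | j}`. -/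
def hypercycle (k m : ℕ) : Hypergraph (Fin m ⊕ Fin m × Fin (k - 2)) where
  vertexSet := Set.univ
  edgeSet := Set.range fun i : Fin m =>
    {x | x = Sum.inl i ∨ x = Sum.inl (finRotate m i) ∨ ∃ j, x = Sum.inr (i, j)}
  subset_vertexSet_of_mem_edgeSet' := fun _ _ => Set.subset_univ _

instance (k m : ℕ) : Fintype (hypercycle k m).vertexSet :=
  inferInstanceAs (Fintype (Set.univ : Set (Fin m ⊕ Fin m × Fin (k - 2))))

/-- The degree of a vertex: the number of hyperedges that contain it. -/
noncomputable def degree (H : Hypergraph β) (v : β) : ℕ := {e ∈ H.edgeSet | v ∈ e}.ncard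

open Classical in
/-- The adjacency tensor of a `k`-uniform hypergraph. -/
noncomputable def adjacencyTensor (H : Hypergraph β) (k : ℕ) : RTensor H.vertexSet k :=
  fun i a =>
    if insert (i : β) (Set.range fun j => (a j : β)) ∈ H.edgeSet then 1 / ((k - 1)! : ℝ) else 0

open Classical in
/-- The diagonal tensor of vertex degrees. -/
noncomputable def degreeTensor (H : Hypergraph β) (k : ℕ) : RTensor H.vertexSet k :=
  fun i a => if ∀ j, a j = i then (H.degree i : ℝ) else 0

/-- The tensor `A_α = α D + (1 - α) A`. -/
noncomputable def alphaTensor (H : Hypergraph β) (k : ℕ) (α : ℝ) : RTensor H.vertexSet k :=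
  α • H.degreeTensor k + (1 - α) • H.adjacencyTensor k

open Classical in
/-- The `d`-th order spectral moment of the tensor `A_α`, that is, its `d`-th order trace. -/
noncomputable def alphaMoment (H : Hypergraph β) [Fintype H.vertexSet] (k : ℕ) (α : ℝ) (d : ℕ) : ℝ :=
  (H.alphaTensor k α).trace d

/-- `H₁` comes before `H₂` in `S_α`-order: both have `n` vertices, and for some
`1 ≤ d ≤ n (k - 1) ^ (n - 1) - 1` the moments of orders `0, …, d - 1` agree, and the `d`-th order
moment of `H₁` is smaller than that of `H₂`. -/
def AlphaBefore (k : ℕ) (α : ℝ) (H₁ : Hypergraph β₁) (H₂ : Hypergraph β₂)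
    [Fintype H₁.vertexSet] [Fintype H₂.vertexSet] : Prop :=
  Fintype.card H₁.vertexSet = Fintype.card H₂.vertexSet ∧
    ∃ d ∈ Set.Icc 1
        (Fintype.card H₁.vertexSet * (k - 1) ^ (Fintype.card H₁.vertexSet - 1) - 1),
      (∀ t < d, H₁.alphaMoment k α t = H₂.alphaMoment k α t) ∧
        H₁.alphaMoment k α d < H₂.alphaMoment k α d

/-- `H₁ =_α H₂`: both have `n` vertices, and their moments of orders
`0, …, n (k - 1) ^ (n - 1) - 1` agree. -/
def AlphaEq (k : ℕ) (α : ℝ) (H₁ : Hypergraph β₁) (H₂ : Hypergraph β₂)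
    [Fintype H₁.vertexSet] [Fintype H₂.vertexSet] : Prop :=
  Fintype.card H₁.vertexSet = Fintype.card H₂.vertexSet ∧
    ∀ t < Fintype.card H₁.vertexSet * (k - 1) ^ (Fintype.card H₁.vertexSet - 1),
      H₁.alphaMoment k α t = H₂.alphaMoment k α t

/-- `H₁ ≼_α H₂`. -/
def AlphaBeforeOrEq (k : ℕ) (α : ℝ) (H₁ : Hypergraph β₁) (H₂ : Hypergraph β₂)
    [Fintype H₁.vertexSet] [Fintype H₂.vertexSet] : Prop :=
  AlphaBefore k α H₁ H₂ ∨ AlphaEq k α H₁ H₂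

end Hypergraph

/-! The trace `Tr_d` of a tensor is a sum over the ways to choose `d` row monomials whose arcs
`(i, a j)` together form a closed walk. In a linear `k`-uniform hypergraph, such a choice with
`d ≤ k + 2` consists of the diagonal terms of a single row, or of one term of a single hyperedge at
each of its vertices, together with diagonal terms at these vertices. So the traces of order below
`k` depend only on the power sums of the degrees, and the traces of order `k + r`, `r ≤ 2`, depend
moreover on sums over the hyperedges of polynomials of degree `r` in the degrees of their vertices.

A linear unicyclic hypergraph has `n = m (k - 1)` vertices and degree sum `k m`. As
`∑ (deg v - 1) (deg v - 2) ≥ 0`, the trace of order `2` is smallest when all degrees are `1` or `2`.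
In that case the degree sequence is determined and the first trace that can differ is that of order
`k + 2`, which then increases with `∑_e (∑_{v ∈ e} deg v) ^ 2`. The inner sums have total
`∑_v (deg v) ^ 2 = m (k + 2)`, so by Cauchy-Schwarz the minimum is attained precisely when each of
them is `k + 2`, that is, when each hyperedge has exactly two vertices of degree `2`. A connected
unicyclic hypergraph with this property is the hypercycle. -/

section ApolarPairing

open MvPolynomial

variable {R σ τ : Type*} [CommSemiring R]

/-- The apolar pairing of polynomials, `(P, Q) ↦` the constant term of `P(∂) Q`. Monomials are
pairwise orthogonal and `X ^ M` pairs with itself to `M!`. -/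
noncomputable def apolarPairing : MvPolynomial σ R →ₗ[R] MvPolynomial σ R →ₗ[R] R :=
  (basisMonomials σ R).constr R fun M => (M.prod fun _ n => (n ! : R)) • lcoeff R M

theorem apolarPairing_monomial (M : σ →₀ ℕ) (Q : MvPolynomial σ R) :
    apolarPairing (monomial M 1) Q = (M.prod fun _ n => (n ! : R)) * coeff M Q := by
  have h := (basisMonomials σ R).constr_basis R
    (fun M => (M.prod fun _ n => (n ! : R)) • lcoeff R M) M
  rw [coe_basisMonomials] at h
  simp [apolarPairing, h]

theorem apolarPairing_one (Q : MvPolynomial σ R) : apolarPairing 1 Q = constantCoeff Q := by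
  simpa [constantCoeff_eq] using apolarPairing_monomial 0 Q

theorem prod_factorial_add_single (M : σ →₀ ℕ) (s : σ) :
    (M + Finsupp.single s 1).prod (fun _ n => (n ! : R)) =
      (M.prod fun _ n => (n ! : R)) * (M s + 1) := by
  have h : (M + Finsupp.single s 1).erase s = M.erase s := by
    simp [Finsupp.erase_add, Finsupp.erase_single]
  rw [← Finsupp.mul_prod_erase' _ s _ (fun _ => by simp), h,
    ← Finsupp.mul_prod_erase' M s _ (fun _ => by simp)]
  simp only [Finsupp.add_apply, Finsupp.single_eq_same, Nat.factorial_succ, Nat.cast_mul,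
    Nat.cast_add, Nat.cast_one]
  ring

theorem apolarPairing_pderiv (s : σ) (P Q : MvPolynomial σ R) :
    apolarPairing P (pderiv s Q) = apolarPairing (P * X s) Q := by
  suffices h : apolarPairing.compl₂ (pderiv s).toLinearMap =
      apolarPairing ∘ₗ LinearMap.mulRight R (X (R := R) s) from
    congrArg (fun B => B P Q) h
  refine (basisMonomials σ R).ext fun M => LinearMap.ext fun Q => ?_
  have hX : monomial M (1 : R) * X s = monomial (M + Finsupp.single s 1) 1 := by
    rw [X, monomial_mul, one_mul]
  simp only [coe_basisMonomials, LinearMap.compl₂_apply, LinearMap.comp_apply,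
    LinearMap.mulRight_apply, Derivation.coeFn_coe, hX,
    apolarPairing_monomial, coeff_pderiv, prod_factorial_add_single]
  ring

theorem apolarPairing_rename (f : σ ≃ τ) (P Q : MvPolynomial σ R) :
    apolarPairing (rename f P) (rename f Q) = apolarPairing P Q := by
  suffices h : apolarPairing.compl₁₂ (rename f).toLinearMap (rename f).toLinearMap =
      apolarPairing (σ := σ) (R := R) from
    congrArg (fun B => B P Q) h
  refine (basisMonomials σ R).ext fun M => LinearMap.ext fun Q => ?_
  simp only [coe_basisMonomials, LinearMap.compl₁₂_apply, AlgHom.toLinearMap_apply,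
    rename_monomial, apolarPairing_monomial, coeff_rename_mapDomain _ f.injective,
    Finsupp.prod_mapDomain_index_inj f.injective]

/-- `O` is the constant-coefficient differential operator `P(∂)`, expressed as being adjoint to
multiplication by `P`. -/
def HasSymbol (O : Module.End R (MvPolynomial σ R)) (P : MvPolynomial σ R) : Prop :=
  ∀ P' Q, apolarPairing P' (O Q) = apolarPairing (P' * P) Q

namespace HasSymbol

variable {κ : Type*} {O O' : Module.End R (MvPolynomial σ R)} {P P' : MvPolynomial σ R}

theorem constantCoeff_apply (h : HasSymbol O P) (Q : MvPolynomial σ R) :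
    constantCoeff (O Q) = apolarPairing P Q := by
  rw [← apolarPairing_one, h, one_mul]

theorem one : HasSymbol (1 : Module.End R (MvPolynomial σ R)) 1 := fun P' Q => by simp

theorem mul (h : HasSymbol O P) (h' : HasSymbol O' P') : HasSymbol (O * O') (P * P') :=
  fun P'' Q => by rw [Module.End.mul_apply, h, h', mul_assoc]

theorem pow (h : HasSymbol O P) (n : ℕ) : HasSymbol (O ^ n) (P ^ n) := by
  induction n with
  | zero => simpa using one
  | succ n ih => simpa only [pow_succ] using ih.mul h

theorem smul (h : HasSymbol O P) (c : R) : HasSymbol (c • O) (c • P) := fun P' Q => by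
  simp [h P' Q]

theorem sum (s : Finset κ) {O : κ → Module.End R (MvPolynomial σ R)} {P : κ → MvPolynomial σ R}
    (h : ∀ i ∈ s, HasSymbol (O i) (P i)) : HasSymbol (∑ i ∈ s, O i) (∑ i ∈ s, P i) :=
  fun P' Q => by
    simp only [LinearMap.sum_apply, map_sum, Finset.mul_sum]
    exact Finset.sum_congr rfl fun i hi => h i hi P' Q

theorem noncommProd (s : Finset κ) {O : κ → Module.End R (MvPolynomial σ R)}
    {P : κ → MvPolynomial σ R} (comm) (h : ∀ i ∈ s, HasSymbol (O i) (P i)) :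
    HasSymbol (s.noncommProd O comm) (∏ i ∈ s, P i) := by
  classical
  induction s using Finset.induction_on with
  | empty => simpa using one
  | insert a s ha ih =>
    rw [Finset.noncommProd_insert_of_notMem _ _ _ _ ha, Finset.prod_insert ha]
    exact (h a (Finset.mem_insert_self a s)).mul
      (ih _ fun i hi => h i (Finset.mem_insert_of_mem hi))

end HasSymbol

end ApolarPairing

namespace RTensor

section Reindex

open MvPolynomial

variable {ι κ : Type*} [Fintype ι] [Fintype κ] {k : ℕ}

/-- The symbol of the operator `∑_a T_{i a} ∂/∂a_{i a}`. -/
noncomputable def rowPoly (T : RTensor ι k) (i : ι) : MvPolynomial (ι × ι) ℝ :=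
  ∑ a : Fin (k - 1) → ι, T i a • ∏ j, X (i, a j)

theorem hasSymbol_rowOperator (T : RTensor ι k) (i : ι) :
    HasSymbol (rowOperator T i) (rowPoly T i) :=
  HasSymbol.sum _ fun _ _ => HasSymbol.smul
    (HasSymbol.noncommProd _ _ fun _ _ => apolarPairing_pderiv _) _

theorem rename_rowPoly (f : ι ≃ κ) (T : RTensor κ k) (i : ι) :
    rename (f.prodCongr f) (rowPoly (fun i a => T (f i) (f ∘ a)) i) = rowPoly T (f i) := by
  simp only [rowPoly, map_sum, map_smul, map_prod, rename_X, Equiv.prodCongr_apply, Prod.map]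
  rw [← (Equiv.arrowCongr (Equiv.refl (Fin (k - 1))) f).sum_comp]
  rfl

variable [DecidableEq ι] [DecidableEq κ]

theorem trace_eq_sum_apolarPairing (T : RTensor ι k) (d : ℕ) :
    T.trace d = ((k : ℝ) - 1) ^ (Fintype.card ι - 1) *
      ∑ D ∈ Finset.piAntidiag (Finset.univ : Finset ι) d,
        (∏ i, (1 / ((D i * (k - 1))! : ℝ))) *
          apolarPairing (∏ i, rowPoly T i ^ D i) (auxTrace ι (d * (k - 1))) := by
  rw [trace]
  congr! 3 with D
  exact (HasSymbol.noncommProd _ _ fun i _ =>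
    (hasSymbol_rowOperator T i).pow (D i)).constantCoeff_apply _

theorem trace_zero_eq (T T' : RTensor ι k) : T.trace 0 = T'.trace 0 := by
  simp [trace_eq_sum_apolarPairing]

theorem rename_auxTrace (f : ι ≃ κ) (N : ℕ) :
    rename (f.prodCongr f) (auxTrace ι N) = auxTrace κ N := by
  have hmap : (rename (f.prodCongr f)).mapMatrix (Matrix.mvPolynomialX ι ι ℝ) =
      Matrix.reindexAlgEquiv ℝ _ f.symm (Matrix.mvPolynomialX κ κ ℝ) := by
    ext i j : 2
    simp [Matrix.mvPolynomialX_apply]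
  calc rename (f.prodCongr f) (auxTrace ι N)
      = ((rename (f.prodCongr f)).mapMatrix (Matrix.mvPolynomialX ι ι ℝ ^ N)).trace :=
        AddMonoidHom.map_trace (rename (f.prodCongr f)) _
    _ = (Matrix.reindexAlgEquiv ℝ _ f.symm (Matrix.mvPolynomialX κ κ ℝ ^ N)).trace := by
        rw [map_pow, hmap, map_pow]
    _ = auxTrace κ N := f.sum_comp fun i => (Matrix.mvPolynomialX κ κ ℝ ^ N) i i

theorem trace_reindex (f : ι ≃ κ) (T : RTensor κ k) (d : ℕ) :
    trace (fun i a => T (f i) (f ∘ a) : RTensor ι k) d = trace T d := by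
  rw [trace_eq_sum_apolarPairing, trace_eq_sum_apolarPairing, Fintype.card_congr f]
  congr 1
  refine Finset.sum_nbij' (· ∘ f.symm) (· ∘ f) ?_ ?_ ?_ ?_ ?_
  · exact fun D hD => by simpa [f.symm.sum_comp D] using hD
  · exact fun D hD => by simpa [f.sum_comp D] using hD
  · exact fun D _ => by ext; simp
  · exact fun D _ => by ext; simp
  · intro D _
    congr 1
    · rw [← f.prod_comp]
      simp
    · rw [← rename_auxTrace f, ← apolarPairing_rename (f.prodCongr f), map_prod, ← f.prod_comp]
      simp only [map_pow, rename_rowPoly, Function.comp_apply, Equiv.symm_apply_apply]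

end Reindex

end RTensor

section ArcWalk

open Finsupp (single)

variable {ι : Type*}

/-- `IsArcWalk i j M`: some walk from `i` to `j` in the complete digraph with loops on `ι` uses each
arc `a` exactly `M a` times. -/
inductive IsArcWalk (i : ι) : ι → (ι × ι →₀ ℕ) → Prop
  | nil : IsArcWalk i i 0
  | snoc {j : ι} {M : ι × ι →₀ ℕ} (h : IsArcWalk i j M) (l : ι) :
      IsArcWalk i l (M + single (j, l) 1)

namespace IsArcWalk

variable {i j l : ι} {M M' : ι × ι →₀ ℕ}

theorem eq_of_zero (h : IsArcWalk i j 0) : i = j := by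
  generalize hM : (0 : ι × ι →₀ ℕ) = M at h
  cases h with
  | nil => rfl
  | snoc h l => simpa using congrArg Finsupp.degree hM

theorem append (h : IsArcWalk i j M) (h' : IsArcWalk j l M') : IsArcWalk i l (M + M') := by
  induction h' with
  | nil => simpa using h
  | snoc _ l ih => simpa only [add_assoc] using ih.snoc l

theorem arc (i j : ι) : IsArcWalk i j (single (i, j) 1) := by
  simpa using (nil (i := i)).snoc j

theorem sum {κ : Type*} (s : Finset κ) {M : κ → ι × ι →₀ ℕ}
    (h : ∀ x ∈ s, IsArcWalk i i (M x)) : IsArcWalk i i (∑ x ∈ s, M x) :=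
  Finset.sum_induction M (IsArcWalk i i) (fun _ _ => append) nil h

theorem loops (i : ι) (n : ℕ) : IsArcWalk i i (single (i, i) n) := by
  simpa using sum (Finset.range n) fun _ _ => arc i i

theorem balanced [Fintype ι] [DecidableEq ι] (h : IsArcWalk i j M) (v : ι) :
    ∑ l, M (v, l) + (if j = v then 1 else 0) = ∑ l, M (l, v) + (if i = v then 1 else 0) := by
  induction h with
  | nil => simp
  | @snoc j M _ l ih =>
    have h_out : ∑ x, single (j, l) 1 (v, x) = if j = v then 1 else 0 := by
      by_cases hj : j = v <;> simp [Finsupp.single_apply, hj]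
    have h_in : ∑ x, single (j, l) 1 (x, v) = if l = v then 1 else 0 := by
      by_cases hl : l = v <;> simp [Finsupp.single_apply, hl]
    simp only [Finsupp.add_apply, Finset.sum_add_distrib, h_out, h_in]
    lia

theorem mem_iff_of_forall_arc (h : IsArcWalk i j M) (S : Set ι)
    (hM : ∀ x y, M (x, y) ≠ 0 → (x ∈ S ↔ y ∈ S)) :
    (i ∈ S ↔ j ∈ S) ∧ ∀ x y, M (x, y) ≠ 0 → (x ∈ S ↔ i ∈ S) := by
  classical
  induction h with
  | nil => simp
  | @snoc j M _ l ih =>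
    obtain ⟨hij, hMi⟩ := ih fun x y hxy => hM x y (by simp [hxy])
    refine ⟨hij.trans (hM j l (by simp)), fun x y hxy => ?_⟩
    by_cases hx : M (x, y) = 0
    · have : (j, l) = (x, y) := by
        by_contra hne
        simp [hx, hne] at hxy
      obtain ⟨rfl, rfl⟩ := Prod.mk.inj this
      exact hij.symm
    · exact hMi x y hx

end IsArcWalk

section CompleteArcs

variable [DecidableEq ι]

/-- The arcs of the complete digraph on `s`, with `l i` loops at each `i ∈ s`. -/
noncomputable def completeArcs (s : Finset ι) (l : ι → ℕ) : ι × ι →₀ ℕ :=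
  ∑ i ∈ s, (single (i, i) (l i) + ∑ j ∈ s.erase i, single (i, j) 1)

theorem completeArcs_insert {s : Finset ι} {x : ι} (hx : x ∉ s) (l : ι → ℕ) :
    completeArcs (insert x s) l = completeArcs s l +
      (single (x, x) (l x) + ∑ j ∈ s, (single (x, j) 1 + single (j, x) 1)) := by
  have h_old : ∀ i ∈ s, single (i, i) (l i) + ∑ j ∈ (insert x s).erase i, single (i, j) 1
      = single (i, i) (l i) + ∑ j ∈ s.erase i, single (i, j) 1 + single (i, x) 1 := by
    intro i hi
    have hxi : x ≠ i := fun h => hx (h ▸ hi)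
    rw [Finset.erase_insert_of_ne hxi, Finset.sum_insert (fun h => hx (Finset.mem_of_mem_erase h))]
    abel
  rw [completeArcs, Finset.sum_insert hx, Finset.erase_insert hx, completeArcs,
    Finset.sum_congr rfl h_old, Finset.sum_add_distrib (f := fun i => _ + _),
    Finset.sum_add_distrib (s := s) (f := fun j => single (x, j) 1)]
  abel

theorem isArcWalk_completeArcs {s : Finset ι} {b : ι} (hb : b ∈ s) (l : ι → ℕ) :
    IsArcWalk b b (completeArcs s l) := by
  obtain ⟨t, hbt, rfl⟩ : ∃ t : Finset ι, b ∉ t ∧ insert b t = s :=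
    ⟨s.erase b, s.notMem_erase b, Finset.insert_erase hb⟩
  clear hb
  induction t using Finset.induction_on with
  | empty => simpa [completeArcs] using IsArcWalk.loops b (l b)
  | insert x t hx ih =>
    obtain ⟨hbx, hbt⟩ := not_or.1 (Finset.mem_insert.not.1 hbt)
    have h_at_x : IsArcWalk x x
        (single (x, x) (l x) + ∑ j ∈ t, (single (x, j) 1 + single (j, x) 1)) :=
      (IsArcWalk.loops x (l x)).append (IsArcWalk.sum _ fun j _ =>
        (IsArcWalk.arc x j).append (IsArcWalk.arc j x))
    have h_detour := ((IsArcWalk.arc b x).append h_at_x).append (IsArcWalk.arc x b)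
    rw [Finset.insert_comm, completeArcs_insert (by simp [Ne.symm hbx, hx]),
      Finset.sum_insert hbt]
    convert (ih hbt).append h_detour using 2
    abel

end CompleteArcs

end ArcWalk

section GenericMatrix

open MvPolynomial
open Finsupp (single)

variable {ι R : Type*} [Fintype ι] [DecidableEq ι] [CommSemiring R]

theorem coeff_mvPolynomialX_pow_succ (N : ℕ) (i j : ι) (M : ι × ι →₀ ℕ) :
    coeff M ((Matrix.mvPolynomialX ι ι R ^ (N + 1)) i j) =
      ∑ l, if (l, j) ∈ M.support then
        coeff (M - single (l, j) 1) ((Matrix.mvPolynomialX ι ι R ^ N) i l) else 0 := by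
  simp only [pow_succ, Matrix.mul_apply, coeff_sum, Matrix.mvPolynomialX_apply, coeff_mul_X']

variable [PartialOrder R] [IsOrderedRing R]

theorem coeff_mvPolynomialX_pow_nonneg (N : ℕ) (i j : ι) (M : ι × ι →₀ ℕ) :
    0 ≤ coeff M ((Matrix.mvPolynomialX ι ι R ^ N) i j) := by
  induction N generalizing j M with
  | zero =>
    rw [pow_zero, Matrix.one_apply]
    split_ifs <;> simp [coeff_one, apply_ite]
  | succ N ih =>
    rw [coeff_mvPolynomialX_pow_succ]
    exact Finset.sum_nonneg fun l _ => by split_ifs; exacts [ih _ _, le_rfl]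

theorem coeff_mvPolynomialX_pow_pos_iff [Nontrivial R] {N : ℕ} {i j : ι} {M : ι × ι →₀ ℕ} :
    0 < coeff M ((Matrix.mvPolynomialX ι ι R ^ N) i j) ↔ IsArcWalk i j M ∧ M.degree = N := by
  induction N generalizing j M with
  | zero =>
    rw [pow_zero, Matrix.one_apply, Finsupp.degree_eq_zero_iff]
    constructor
    · intro h
      split_ifs at h with hij
      · rw [coeff_one] at h
        split_ifs at h with hM
        · exact ⟨hij ▸ hM ▸ .nil, hM.symm⟩
        · exact absurd h (lt_irrefl _)
      · simp at h
    · rintro ⟨h, rfl⟩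
      simp [h.eq_of_zero]
  | succ N ih =>
    rw [coeff_mvPolynomialX_pow_succ, Finset.sum_pos_iff_of_nonneg fun l _ => by
      split_ifs; exacts [coeff_mvPolynomialX_pow_nonneg _ _ _ _, le_rfl]]
    constructor
    · rintro ⟨l, -, hl⟩
      split_ifs at hl with hmem
      · obtain ⟨hwalk, hdeg⟩ := ih.1 hl
        have hM : M - single (l, j) 1 + single (l, j) 1 = M := tsub_add_cancel_of_le <| by
          rw [Finsupp.single_le_iff]
          exact Nat.one_le_iff_ne_zero.2 (Finsupp.mem_support_iff.1 hmem)
        rw [← hM]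
        exact ⟨hwalk.snoc j, by simp [hdeg]⟩
      · exact absurd hl (lt_irrefl _)
    · rintro ⟨h, hdeg⟩
      cases h with
      | nil => simp at hdeg
      | @snoc l M h =>
        refine ⟨l, Finset.mem_univ _, ?_⟩
        rw [if_pos (by simp), add_tsub_cancel_right, ih]
        exact ⟨h, by simpa using hdeg⟩

end GenericMatrix

namespace RTensor

open MvPolynomial

variable {ι : Type*} [Fintype ι] [DecidableEq ι] {N : ℕ} {M : ι × ι →₀ ℕ}

theorem coeff_auxTrace_pos_iff :
    0 < coeff M (auxTrace ι N) ↔ (∃ i, IsArcWalk i i M) ∧ M.degree = N := by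
  simp only [auxTrace, Matrix.trace, Matrix.diag_apply, coeff_sum, Finset.mem_univ, true_and,
    Finset.sum_pos_iff_of_nonneg fun i _ => coeff_mvPolynomialX_pow_nonneg N i i M,
    coeff_mvPolynomialX_pow_pos_iff, exists_and_right]

theorem exists_isArcWalk_of_coeff_auxTrace_ne_zero (h : coeff M (auxTrace ι N) ≠ 0) :
    ∃ i, IsArcWalk i i M := by
  refine (coeff_auxTrace_pos_iff.1 (h.lt_of_le' ?_)).1
  rw [auxTrace, Matrix.trace, coeff_sum]
  exact Finset.sum_nonneg fun i _ => coeff_mvPolynomialX_pow_nonneg N i i M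

end RTensor

section TermsOfHyperedge

open MvPolynomial
open Finsupp (single)

variable {ι κ : Type*} [DecidableEq ι] [Fintype κ] {e : Finset ι} {i : ι}

theorem injective_and_image_eq_of_insert_image_eq {a : κ → ι}
    (he : e.card = Fintype.card κ + 1) (ha : insert i (Finset.univ.image a) = e) :
    Function.Injective a ∧ Finset.univ.image a = e.erase i := by
  have hle : (Finset.univ.image a).card ≤ Fintype.card κ := Finset.card_image_le
  have hi : i ∉ Finset.univ.image a := by
    intro hmem
    rw [Finset.insert_eq_of_mem hmem] at ha
    lia
  have himage : Finset.univ.image a = e.erase i := by rw [← ha, Finset.erase_insert hi]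
  refine ⟨?_, himage⟩
  rw [← Set.injOn_univ, ← Finset.coe_univ, ← Finset.card_image_iff, himage,
    Finset.card_erase_of_mem (ha ▸ Finset.mem_insert_self _ _), he, Nat.add_sub_cancel,
    Finset.card_univ]

theorem card_filter_insert_image_eq [Fintype ι] [DecidableEq κ]
    (he : e.card = Fintype.card κ + 1) (hi : i ∈ e) :
    (Finset.univ.filter fun a : κ → ι => insert i (Finset.univ.image a) = e).card
      = (Fintype.card κ)! := by
  have hcard : Fintype.card κ = Fintype.card (e.erase i) := by
    rw [Fintype.card_coe, Finset.card_erase_of_mem hi, he, Nat.add_sub_cancel]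
  rw [← Fintype.card_equiv (Fintype.equivOfCardEq hcard), ← Finset.card_univ]
  refine (Finset.card_bij (fun f _ j => (f j : ι)) ?_ ?_ ?_).symm
  · intro f _
    have himage : Finset.univ.image (fun j => (f j : ι)) = e.erase i := by
      ext x
      simp only [Finset.mem_image, Finset.mem_univ, true_and]
      exact ⟨fun ⟨j, hj⟩ => hj ▸ (f j).2, fun hx => ⟨f.symm ⟨x, hx⟩, by simp⟩⟩
    rw [Finset.mem_filter_univ, himage, Finset.insert_erase hi]
  · intro f _ g _ hfg
    ext j
    exact congrFun hfg j
  · intro a ha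
    obtain ⟨hinj, himage⟩ :=
      injective_and_image_eq_of_insert_image_eq he (Finset.mem_filter.1 ha).2
    have hmem (j) : a j ∈ e.erase i := himage ▸ Finset.mem_image_of_mem _ (Finset.mem_univ j)
    have hbij : Function.Bijective fun j => (⟨a j, hmem j⟩ : e.erase i) :=
      (Fintype.bijective_iff_injective_and_card _).2
        ⟨fun x y hxy => hinj (congrArg Subtype.val hxy), hcard⟩
    exact ⟨Equiv.ofBijective _ hbij, Finset.mem_univ _, rfl⟩

/-- The exponents of the monomials of the `i`-th row of the tensor of a `k`-uniform family: `none`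
stands for the diagonal entry and `some e` for the entries of the hyperedge `e`. -/
noncomputable def termArcs (k : ℕ) (i : ι) : Option (Finset ι) → (ι × ι →₀ ℕ)
  | none => single (i, i) (k - 1)
  | some e => ∑ j ∈ e.erase i, single (i, j) 1

theorem prod_X_eq_of_insert_image_eq {R : Type*} [CommSemiring R] {a : κ → ι} (k : ℕ)
    (he : e.card = Fintype.card κ + 1) (ha : insert i (Finset.univ.image a) = e) :
    ∏ j, (X (i, a j) : MvPolynomial (ι × ι) R) = monomial (termArcs k i (some e)) 1 := by
  obtain ⟨hinj, himage⟩ := injective_and_image_eq_of_insert_image_eq he ha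
  rw [termArcs, ← himage, Finset.sum_image fun x _ y _ h => hinj h, monomial_sum_one]
  rfl

end TermsOfHyperedge

namespace RTensor

section FamilyTensor

open MvPolynomial

variable {ι : Type*} [DecidableEq ι]

/-- The number of members of `E` that contain `i`. -/
def familyDegree (E : Finset (Finset ι)) (i : ι) : ℕ := (E.filter fun e => i ∈ e).card

/-- The tensor `α D + (1 - α) A` of a family `E` of hyperedges. -/
noncomputable def familyTensor (E : Finset (Finset ι)) (k : ℕ) (α : ℝ) : RTensor ι k := fun i a =>
  α * (if ∀ j, a j = i then (familyDegree E i : ℝ) else 0) +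
    (1 - α) * (if insert i (Finset.univ.image a) ∈ E then 1 / ((k - 1)! : ℝ) else 0)

/-- The coefficient of `termArcs k i o` in the `i`-th row of `familyTensor E k α`. -/
noncomputable def termCoeff (E : Finset (Finset ι)) (α : ℝ) (i : ι) : Option (Finset ι) → ℝ
  | none => α * familyDegree E i
  | some e => if e ∈ E ∧ i ∈ e then 1 - α else 0

variable [Fintype ι] {E : Finset (Finset ι)} {k : ℕ}

theorem sum_smul_prod_X_eq_sum_termCoeff (hk : 1 ≤ k) (hE : ∀ e ∈ E, e.card = k) (α : ℝ) (i : ι) :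
    ∑ a : Fin (k - 1) → ι,
        ((1 - α) * (if insert i (Finset.univ.image a) ∈ E then 1 / ((k - 1)! : ℝ) else 0)) •
          ∏ j, (X (i, a j) : MvPolynomial (ι × ι) ℝ) =
      ∑ e, termCoeff E α i (some e) • monomial (termArcs k i (some e)) 1 := by
  have hcard : ∀ e ∈ E, e.card = Fintype.card (Fin (k - 1)) + 1 := fun e he => by
    rw [hE e he, Fintype.card_fin, Nat.sub_add_cancel hk]
  have h_single (a : Fin (k - 1) → ι) :
      ((1 - α) * (if insert i (Finset.univ.image a) ∈ E then 1 / ((k - 1)! : ℝ) else 0)) •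
          ∏ j, (X (i, a j) : MvPolynomial (ι × ι) ℝ) =
        ∑ e : Finset ι, if insert i (Finset.univ.image a) = e then
          (termCoeff E α i (some e) / ((k - 1)! : ℝ)) •
            (monomial (termArcs k i (some e)) 1 : MvPolynomial (ι × ι) ℝ) else 0 := by
    rw [Finset.sum_ite_eq, if_pos (Finset.mem_univ _)]
    by_cases h : insert i (Finset.univ.image a) ∈ E
    · simp only [termCoeff, h, Finset.mem_insert_self, and_self, if_true, mul_one_div,
        prod_X_eq_of_insert_image_eq k (hcard _ h) rfl]
    · simp [termCoeff, h]
  simp only [h_single]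
  rw [Finset.sum_comm]
  refine Finset.sum_congr rfl fun e _ => ?_
  rw [← Finset.sum_filter, Finset.sum_const]
  by_cases h : e ∈ E ∧ i ∈ e
  · rw [card_filter_insert_image_eq (hcard e h.1) h.2, ← Nat.cast_smul_eq_nsmul ℝ, smul_smul,
      Fintype.card_fin, mul_div_cancel₀ _ (by exact_mod_cast Nat.factorial_ne_zero _)]
  · simp [termCoeff, h]

theorem rowPoly_familyTensor (hk : 1 ≤ k) (hE : ∀ e ∈ E, e.card = k) (α : ℝ) (i : ι) :
    rowPoly (familyTensor E k α) i = ∑ o, termCoeff E α i o • monomial (termArcs k i o) 1 := by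
  rw [Fintype.sum_option, ← sum_smul_prod_X_eq_sum_termCoeff hk hE]
  simp only [rowPoly, familyTensor, add_smul, Finset.sum_add_distrib]
  congr 1
  rw [Fintype.sum_eq_single fun _ => i]
  · simp [termCoeff, termArcs, X_pow_eq_monomial]
  · exact fun a ha => by rw [if_neg fun h => ha (funext h), mul_zero, zero_smul]

/-- The exponent of a product of row monomials, the term `o` of row `i` being taken `Q i o`
times. -/
noncomputable def productArcs (k : ℕ) (Q : ι → Option (Finset ι) → ℕ) : ι × ι →₀ ℕ :=
  ∑ i, ∑ o, Q i o • termArcs k i o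

/-- The coefficient with which the choice `Q` of terms occurs in a product of powers of rows of
`familyTensor E k α`. -/
noncomputable def productCoeff (E : Finset (Finset ι)) (α : ℝ) (Q : ι → Option (Finset ι) → ℕ) :
    ℝ :=
  ∏ i, ((Nat.multinomial Finset.univ (Q i) : ℝ) * ∏ o, termCoeff E α i o ^ Q i o)

theorem prod_rowPoly_pow (hk : 1 ≤ k) (hE : ∀ e ∈ E, e.card = k) (α : ℝ) (D : ι → ℕ) :
    ∏ i, rowPoly (familyTensor E k α) i ^ D i =
      ∑ Q ∈ Fintype.piFinset fun i => Finset.piAntidiag Finset.univ (D i),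
        productCoeff E α Q • (monomial (productArcs k Q) 1 : MvPolynomial (ι × ι) ℝ) := by
  simp only [rowPoly_familyTensor hk hE, Finset.sum_pow_eq_sum_piAntidiag]
  rw [Finset.prod_univ_sum]
  refine Finset.sum_congr rfl fun Q _ => ?_
  rw [productCoeff, productArcs, monomial_sum_one, ← Finset.prod_smul]
  refine Finset.prod_congr rfl fun i _ => ?_
  rw [monomial_sum_one, mul_smul, Nat.cast_smul_eq_nsmul, nsmul_eq_mul, ← Finset.prod_smul]
  simp only [smul_pow, monomial_pow, one_pow]

end FamilyTensor

end RTensor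

section LinearUniform

variable {ι : Type*} [DecidableEq ι]

/-- The members of `E` have `k` elements each, and any two of them have at most one common element:
a `k`-uniform linear hypergraph on `ι`. -/
structure IsLinearUniform (E : Finset (Finset ι)) (k : ℕ) : Prop where
  card_eq : ∀ e ∈ E, e.card = k
  card_inter_le : ∀ e ∈ E, ∀ f ∈ E, e ≠ f → (e ∩ f).card ≤ 1

variable [Fintype ι]

theorem sum_mem_sum_filter_mem (e : Finset ι) (p : Finset ι → ℕ) :
    ∑ v ∈ e, ∑ f with v ∈ f, p f = ∑ f, (e ∩ f).card * p f := by
  simp only [Finset.sum_filter]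
  rw [Finset.sum_comm]
  refine Finset.sum_congr rfl fun f _ => ?_
  rw [← Finset.sum_filter, Finset.sum_const, smul_eq_mul, Finset.filter_mem_eq_inter]

variable {E : Finset (Finset ι)} {k : ℕ} {p : Finset ι → ℕ}

theorem sum_filter_mem_eq_of_dvd (hdvd : ∀ v, k ∣ ∑ e with v ∈ e, p e) (hk : 3 ≤ k)
    (hsum : ∑ e, p e ≤ k + 2) {e : Finset ι} (he : p e ≠ 0) {v : ι} (hv : v ∈ e) :
    ∑ f with v ∈ f, p f = k := by
  have hle : ∑ f with v ∈ f, p f ≤ k + 2 :=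
    (Finset.sum_le_sum_of_subset (Finset.filter_subset _ _)).trans hsum
  have hpos : p e ≤ ∑ f with v ∈ f, p f :=
    Finset.single_le_sum (f := p) (fun _ _ => Nat.zero_le _) (by simp [hv])
  refine Nat.eq_of_dvd_of_lt_two_mul (by lia) (hdvd v) (by lia)

namespace IsLinearUniform

/-- Count the weights at the vertices of `e`: they sum to `k * k`, but every other member of `E`
contributes its weight at most once. -/
theorem le_weight_add_one (hE : IsLinearUniform E k) (hk : 3 ≤ k) (hp : ∀ e, p e ≠ 0 → e ∈ E)
    (hsum : ∑ e, p e ≤ k + 2) {e : Finset ι} (he : p e ≠ 0)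
    (hvertex : ∀ v ∈ e, ∑ f with v ∈ f, p f = k) : k ≤ p e + 1 := by
  have hcount : ∑ f, (e ∩ f).card * p f = k * k := by
    rw [← sum_mem_sum_filter_mem, Finset.sum_congr rfl hvertex, Finset.sum_const,
      hE.card_eq e (hp e he), smul_eq_mul]
  have hle : ∑ f, (e ∩ f).card * p f ≤ ∑ f, (p f + if f = e then (k - 1) * p e else 0) := by
    refine Finset.sum_le_sum fun f _ => ?_
    obtain rfl | hfe := eq_or_ne f e
    · rw [Finset.inter_self, hE.card_eq f (hp f he), if_pos rfl, ← one_add_mul,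
        Nat.add_sub_cancel' (by lia)]
    · rw [if_neg hfe, add_zero]
      obtain hf | hf := eq_or_ne (p f) 0
      · simp [hf]
      · exact (Nat.mul_le_mul_right _ (hE.card_inter_le e (hp e he) f (hp f hf) hfe.symm)).trans
          (one_mul _).le
  rw [Finset.sum_add_distrib, Finset.sum_ite_eq' Finset.univ e, if_pos (Finset.mem_univ _),
    hcount] at hle
  by_contra! hlt
  obtain ⟨k, rfl⟩ := Nat.exists_eq_add_of_le' hk
  have : (k + 3 - 1) * p e ≤ (k + 2) * (k + 1) := Nat.mul_le_mul (by lia) (by lia)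
  nlinarith

/-- If `p` had a second member of its support at a vertex of `e`, the two weights would be at least
`k - 1` each while their sum is at most `k`. -/
theorem weight_eq (hE : IsLinearUniform E k) (hk : 3 ≤ k) (hp : ∀ e, p e ≠ 0 → e ∈ E)
    (hsum : ∑ e, p e ≤ k + 2) (hvertex : ∀ e, p e ≠ 0 → ∀ v ∈ e, ∑ f with v ∈ f, p f = k)
    {e : Finset ι} (he : p e ≠ 0) : p e = k := by
  have hle (f) (hf : p f ≠ 0) := hE.le_weight_add_one hk hp hsum hf (hvertex f hf)
  obtain ⟨v, hv⟩ : e.Nonempty := by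
    rw [← Finset.card_pos, hE.card_eq e (hp e he)]
    lia
  have hsum_v := hvertex e he v hv
  rw [← Finset.add_sum_erase _ _ (show e ∈ Finset.univ.filter (v ∈ ·) by simp [hv])] at hsum_v
  have he_ge := hle e he
  by_contra hne
  obtain ⟨f, hf, hf0⟩ := Finset.exists_ne_zero_of_sum_ne_zero
    (show ∑ x ∈ (Finset.univ.filter (v ∈ ·)).erase e, p x ≠ 0 by lia)
  have hf_le := Finset.single_le_sum (f := p) (fun _ _ => Nat.zero_le _) hf
  have hf_ge := hle f hf0
  lia

theorem eq_zero_or_concentrated (hE : IsLinearUniform E k) (hk : 3 ≤ k)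
    (hp : ∀ e, p e ≠ 0 → e ∈ E) (hdvd : ∀ v, k ∣ ∑ e with v ∈ e, p e)
    (hsum : ∑ e, p e ≤ k + 2) :
    p = 0 ∨ ∃ e ∈ E, p = Pi.single e k := by
  have hweight (e) (he : p e ≠ 0) : p e = k := hE.weight_eq hk hp hsum
    (fun e he v hv => sum_filter_mem_eq_of_dvd hdvd hk hsum he hv) he
  refine or_iff_not_imp_left.2 fun h0 => ?_
  obtain ⟨e, he⟩ := Function.ne_iff.1 h0
  refine ⟨e, hp e he, funext fun f => ?_⟩
  obtain rfl | hf := eq_or_ne f e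
  · rw [Pi.single_eq_same, hweight f he]
  rw [Pi.single_eq_of_ne hf]
  by_contra hf0
  have hpair := Finset.sum_le_sum_of_subset (f := p) (Finset.subset_univ {e, f})
  rw [Finset.sum_pair hf.symm, hweight e he, hweight f hf0] at hpair
  lia

end IsLinearUniform

end LinearUniform

section ClosedChoice

open Finsupp (single)
open RTensor (productArcs)

variable {ι : Type*} [DecidableEq ι]

theorem termArcs_none_apply (k : ℕ) (i x y : ι) :
    termArcs k i none (x, y) = if i = x ∧ i = y then k - 1 else 0 := by
  simp only [termArcs, Finsupp.single_apply, Prod.mk.injEq]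

theorem termArcs_some_apply (k : ℕ) (i x y : ι) (e : Finset ι) :
    termArcs k i (some e) (x, y) = if i = x ∧ y ∈ e ∧ y ≠ i then 1 else 0 := by
  simp only [termArcs, Finsupp.finsetSum_apply, Finsupp.single_apply, Prod.mk.injEq]
  by_cases h : i = x
  · simp [h, and_comm]
  · simp [h]

/-- The choice of `d` diagonal terms in row `i` and of nothing in the other rows. -/
def loopChoice (i : ι) (d : ℕ) (j : ι) : Option (Finset ι) → ℕ
  | none => if j = i then d else 0
  | some _ => 0

/-- The choice of one term of the hyperedge `e` in each row of `e`, and of `l i` diagonal terms in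
each row `i`. -/
def edgeChoice (e : Finset ι) (l : ι → ℕ) (i : ι) : Option (Finset ι) → ℕ
  | none => l i
  | some f => if f = e ∧ i ∈ e then 1 else 0

variable [Fintype ι]

theorem productArcs_apply (k : ℕ) (Q : ι → Option (Finset ι) → ℕ) (x y : ι) :
    productArcs k Q (x, y) = (if x = y then Q x none * (k - 1) else 0) +
      ∑ e, if y ∈ e ∧ y ≠ x then Q x (some e) else 0 := by
  simp only [productArcs, Finsupp.finsetSum_apply, Finsupp.add_apply, Finsupp.smul_apply,
    Fintype.sum_option, termArcs_none_apply, termArcs_some_apply, smul_eq_mul, mul_ite, mul_zero,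
    mul_one]
  rw [Fintype.sum_eq_single x fun i hi => by simp [hi]]
  simp

/-- `Q` chooses `Q i o` times the term `o` of row `i`, only hyperedges of `E` at their vertices
being used, in such a way that the chosen arcs form a closed walk. These are the choices that
contribute to the traces of the tensor of `E`. -/
structure IsClosedChoice (E : Finset (Finset ι)) (k : ℕ) (Q : ι → Option (Finset ι) → ℕ) :
    Prop where
  mem : ∀ i e, Q i (some e) ≠ 0 → e ∈ E ∧ i ∈ e
  exists_isArcWalk : ∃ b, IsArcWalk b b (productArcs k Q)

namespace IsClosedChoice

variable {E : Finset (Finset ι)} {k : ℕ} {Q : ι → Option (Finset ι) → ℕ}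

theorem sum_productArcs_out (hQ : IsClosedChoice E k Q) (hE : ∀ e ∈ E, e.card = k) (v : ι) :
    ∑ y, productArcs k Q (v, y) = Q v none * (k - 1) + (k - 1) * ∑ e, Q v (some e) := by
  simp only [productArcs_apply, Finset.sum_add_distrib, Finset.sum_ite_eq, Finset.mem_univ,
    if_true, Finset.mul_sum]
  congr 1
  rw [Finset.sum_comm]
  refine Finset.sum_congr rfl fun e _ => ?_
  by_cases h0 : Q v (some e) = 0
  · simp [h0]
  obtain ⟨he, hv⟩ := hQ.mem v e h0
  have hfilter : Finset.univ.filter (fun y => y ∈ e ∧ y ≠ v) = e.erase v := by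
    ext y
    simp [and_comm]
  rw [← Finset.sum_filter, Finset.sum_const, smul_eq_mul, hfilter, Finset.card_erase_of_mem hv,
    hE e he]

theorem sum_productArcs_in (hQ : IsClosedChoice E k Q) (v : ι) :
    ∑ x, productArcs k Q (x, v) + ∑ e, Q v (some e) =
      Q v none * (k - 1) + ∑ e with v ∈ e, ∑ i, Q i (some e) := by
  simp only [productArcs_apply, Finset.sum_add_distrib, Finset.sum_ite_eq', Finset.mem_univ,
    if_true]
  rw [add_assoc]
  congr 1
  rw [Finset.sum_comm, ← Finset.sum_add_distrib, Finset.sum_filter]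
  refine Finset.sum_congr rfl fun e _ => ?_
  by_cases hv : v ∈ e
  · rw [if_pos hv, ← Finset.sum_erase_add _ _ (Finset.mem_univ v),
      ← Finset.sum_erase_add _ (fun i => Q i (some e)) (Finset.mem_univ v)]
    simp only [ne_eq, not_true_eq_false, and_false, if_false, add_zero]
    congr 1
    exact Finset.sum_congr rfl fun i hi => if_pos ⟨hv, (Finset.ne_of_mem_erase hi).symm⟩
  · have : Q v (some e) = 0 := by_contra fun h => hv (hQ.mem v e h).2
    simp [hv, this]

/-- A closed walk leaves `v` as often as it enters `v`. -/
theorem mul_sum_some_eq (hQ : IsClosedChoice E k Q) (hk : 1 ≤ k) (hE : ∀ e ∈ E, e.card = k)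
    (v : ι) : k * ∑ e, Q v (some e) = ∑ e with v ∈ e, ∑ i, Q i (some e) := by
  obtain ⟨b, hb⟩ := hQ.exists_isArcWalk
  have hbalanced := hb.balanced v
  rw [add_left_inj, hQ.sum_productArcs_out hE] at hbalanced
  have hin := hQ.sum_productArcs_in v
  obtain ⟨k, rfl⟩ := Nat.exists_eq_add_of_le' hk
  rw [← hbalanced, Nat.add_sub_cancel] at hin
  linarith

theorem sum_some_eq_zero_or_single (hQ : IsClosedChoice E k Q) (hE : IsLinearUniform E k)
    (hk : 3 ≤ k) (hsum : ∑ i, ∑ o, Q i o ≤ k + 2) :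
    (fun e => ∑ i, Q i (some e)) = 0 ∨
      ∃ e ∈ E, (fun e => ∑ i, Q i (some e)) = Pi.single e k := by
  refine hE.eq_zero_or_concentrated hk ?_
    (fun v => ⟨_, (hQ.mul_sum_some_eq (by lia) hE.card_eq v).symm⟩) ?_
  · intro e he
    obtain ⟨i, -, hi⟩ := Finset.exists_ne_zero_of_sum_ne_zero he
    exact (hQ.mem i e hi).1
  · rw [Finset.sum_comm]
    exact (Finset.sum_le_sum fun i _ => by rw [Fintype.sum_option]; lia).trans hsum

theorem exists_eq_loopChoice (hQ : IsClosedChoice E k Q) (hk : 2 ≤ k)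
    (h : ∀ i e, Q i (some e) = 0) : ∃ i d, Q = loopChoice i d := by
  obtain ⟨b, hb⟩ := hQ.exists_isArcWalk
  have harcs (x y : ι) : productArcs k Q (x, y) = if x = y then Q x none * (k - 1) else 0 := by
    simp [productArcs_apply, h]
  have hloop (j : ι) (hj : Q j none ≠ 0) : b = j := by
    refine ((hb.mem_iff_of_forall_arc {j} fun x y hxy => ?_).2 j j ?_).1 rfl
    · rw [harcs] at hxy
      rw [(ite_ne_right_iff.1 hxy).1]
    · rw [harcs, if_pos rfl]
      exact Nat.mul_ne_zero hj (by lia)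
  refine ⟨b, Q b none, funext fun i => funext fun o => ?_⟩
  cases o with
  | some e => exact h i e
  | none =>
    rw [loopChoice]
    split_ifs with hi
    · rw [hi]
    · exact by_contra fun h => hi (hloop i h).symm

section Concentrated

variable {e : Finset ι}

theorem some_eq_ite (hQ : IsClosedChoice E k Q) (hk : 1 ≤ k) (hE : ∀ e ∈ E, e.card = k)
    (h : (fun e => ∑ i, Q i (some e)) = Pi.single e k) (i : ι) (f : Finset ι) :
    Q i (some f) = if f = e ∧ i ∈ e then 1 else 0 := by
  have hp (f) : ∑ i, Q i (some f) = (Pi.single e k : Finset ι → ℕ) f := congrFun h f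
  have hne (i : ι) (f : Finset ι) (hf : f ≠ e) : Q i (some f) = 0 :=
    Finset.sum_eq_zero_iff.1 (by rw [hp f, Pi.single_eq_of_ne hf]) i (Finset.mem_univ i)
  split_ifs with hfi
  · obtain ⟨rfl, hi⟩ := hfi
    have hmul := hQ.mul_sum_some_eq hk hE i
    rw [Fintype.sum_eq_single f (hne i), Finset.sum_congr rfl fun f _ => hp f,
      Finset.sum_eq_single_of_mem f (by simpa using hi) fun g _ hg => Pi.single_eq_of_ne hg _,
      Pi.single_eq_same] at hmul
    exact Nat.eq_of_mul_eq_mul_left hk (hmul.trans (mul_one k).symm)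
  · by_contra h0
    have hf : f = e := by_contra fun hf => h0 (hne i f hf)
    exact hfi ⟨hf, hf ▸ (hQ.mem i f h0).2⟩

/-- No arc joins `e` to its complement, so by connectedness all loops are at vertices of `e`. -/
theorem mem_of_none_ne_zero (hQ : IsClosedChoice E k Q) (hk : 2 ≤ k) (he : e.card = k)
    (h : ∀ i f, Q i (some f) = if f = e ∧ i ∈ e then 1 else 0) {i : ι} (hi : Q i none ≠ 0) :
    i ∈ e := by
  have harcs (x y : ι) : productArcs k Q (x, y) = (if x = y then Q x none * (k - 1) else 0) +
      if (y ∈ e ∧ y ≠ x) ∧ x ∈ e then 1 else 0 := by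
    rw [productArcs_apply, Fintype.sum_eq_single e fun f hf => by simp [h, hf], ite_and, h]
    simp [ite_and]
  obtain ⟨b, hb⟩ := hQ.exists_isArcWalk
  have hmem := (hb.mem_iff_of_forall_arc (e : Set ι) fun x y hxy => ?_).2
  · obtain ⟨x, hx, y, hy, hxy⟩ := Finset.one_lt_card.1 (he.symm ▸ hk : 1 < e.card)
    have hbe := (hmem x y (by rw [harcs, if_neg hxy]; simp [hx, hy, hxy.symm])).1 hx
    refine (hmem i i ?_).2 hbe
    rw [harcs, if_pos rfl]
    have : 0 < Q i none * (k - 1) := Nat.mul_pos (Nat.pos_of_ne_zero hi) (by lia)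
    lia
  · rw [harcs] at hxy
    by_cases hxy' : x = y
    · rw [hxy']
    · rw [if_neg hxy', zero_add, ite_ne_right_iff] at hxy
      exact iff_of_true hxy.1.2 hxy.1.1.1

end Concentrated

theorem eq_loopChoice_or_edgeChoice (hQ : IsClosedChoice E k Q) (hE : IsLinearUniform E k)
    (hk : 3 ≤ k) (hsum : ∑ i, ∑ o, Q i o ≤ k + 2) :
    (∃ i d, Q = loopChoice i d) ∨
      ∃ e ∈ E, ∃ l : ι → ℕ, (∀ i, l i ≠ 0 → i ∈ e) ∧ Q = edgeChoice e l := by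
  obtain h | ⟨e, he, h⟩ := hQ.sum_some_eq_zero_or_single hE hk hsum
  · refine .inl (hQ.exists_eq_loopChoice (by lia) fun i e => ?_)
    exact Finset.sum_eq_zero_iff.1 (congrFun h e) i (Finset.mem_univ i)
  · have hsome := hQ.some_eq_ite (by lia) hE.card_eq h
    refine .inr ⟨e, he, (Q · none),
      fun i => hQ.mem_of_none_ne_zero (by lia) (hE.card_eq e he) hsome, ?_⟩
    funext i o
    cases o with
    | none => rfl
    | some f => exact hsome i f

end IsClosedChoice

end ClosedChoice

namespace RTensor

section Choices

open MvPolynomial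

variable {ι : Type*} [DecidableEq ι]

theorem edgeChoice_injective {e f : Finset ι} {l l' : ι → ℕ} (he : e.Nonempty)
    (h : edgeChoice e l = edgeChoice f l') : e = f ∧ l = l' := by
  refine ⟨?_, funext fun i => congrFun (congrFun h i) none⟩
  obtain ⟨i, hi⟩ := he
  have := congrFun (congrFun h i) (some e)
  by_contra hne
  simp [edgeChoice, hi, hne] at this

variable [Fintype ι]

/-- The choices of `d` row terms in total. -/
noncomputable def choices (ι : Type*) [DecidableEq ι] [Fintype ι] (d : ℕ) :
    Finset (ι → Option (Finset ι) → ℕ) :=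
  (Finset.piAntidiag Finset.univ d).biUnion fun D =>
    Fintype.piFinset fun i => Finset.piAntidiag Finset.univ (D i)

variable {d : ℕ} {Q : ι → Option (Finset ι) → ℕ}

theorem mem_piFinset_piAntidiag_univ {D : ι → ℕ} :
    Q ∈ (Fintype.piFinset fun i => Finset.piAntidiag Finset.univ (D i)) ↔
      (fun i => ∑ o, Q i o) = D := by
  simp [Fintype.mem_piFinset, funext_iff]

theorem mem_choices : Q ∈ choices ι d ↔ ∑ i, ∑ o, Q i o = d := by
  simp only [choices, Finset.mem_biUnion, mem_piFinset_piAntidiag_univ, exists_eq_right',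
    Finset.mem_piAntidiag, Finset.mem_univ, implies_true, and_true]

/-- The contribution of the choice `Q` to the trace of `familyTensor E k α`, up to the factor
`(k - 1) ^ (n - 1)`. -/
noncomputable def choiceTerm (E : Finset (Finset ι)) (k : ℕ) (α : ℝ)
    (Q : ι → Option (Finset ι) → ℕ) : ℝ :=
  (∏ i, (1 / (((∑ o, Q i o) * (k - 1))! : ℝ))) * (productCoeff E α Q *
    apolarPairing (monomial (productArcs k Q) 1) (auxTrace ι ((∑ i, ∑ o, Q i o) * (k - 1))))

variable {E : Finset (Finset ι)} {k : ℕ} {α : ℝ}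

theorem trace_familyTensor_eq_sum_choiceTerm (hk : 1 ≤ k) (hE : ∀ e ∈ E, e.card = k) (α : ℝ)
    (d : ℕ) : (familyTensor E k α).trace d =
      ((k : ℝ) - 1) ^ (Fintype.card ι - 1) * ∑ Q ∈ choices ι d, choiceTerm E k α Q := by
  have hdisjoint : Set.PairwiseDisjoint
      ((Finset.piAntidiag Finset.univ d : Finset (ι → ℕ)) : Set (ι → ℕ))
      fun D => Fintype.piFinset fun i =>
        (Finset.piAntidiag Finset.univ (D i) : Finset (Option (Finset ι) → ℕ)) :=
    fun D _ D' _ hne => Finset.disjoint_left.2 fun Q hQ hQ' => hne <|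
      (mem_piFinset_piAntidiag_univ.1 hQ).symm.trans (mem_piFinset_piAntidiag_univ.1 hQ')
  rw [trace_eq_sum_apolarPairing, choices, Finset.sum_biUnion hdisjoint]
  congr 1
  refine Finset.sum_congr rfl fun D hD => ?_
  rw [prod_rowPoly_pow hk hE, map_sum, LinearMap.sum_apply, Finset.mul_sum]
  refine Finset.sum_congr rfl fun Q hQ => ?_
  obtain rfl := mem_piFinset_piAntidiag_univ.1 hQ
  rw [map_smul, LinearMap.smul_apply, smul_eq_mul, choiceTerm]
  rw [show ∑ i, ∑ o, Q i o = d from (Finset.mem_piAntidiag.1 hD).1]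

theorem apolarPairing_auxTrace_ne_zero_iff {N : ℕ} {M : ι × ι →₀ ℕ} :
    apolarPairing (monomial M 1) (auxTrace ι N) ≠ 0 ↔ coeff M (auxTrace ι N) ≠ 0 := by
  rw [apolarPairing_monomial, mul_ne_zero_iff, and_iff_right]
  exact Finset.prod_ne_zero_iff.2 fun x _ => Nat.cast_ne_zero.2 (Nat.factorial_ne_zero _)

theorem apolarPairing_auxTrace_pos {M : ι × ι →₀ ℕ} {i : ι} (h : IsArcWalk i i M) :
    0 < apolarPairing (monomial M 1) (auxTrace ι M.degree) := by
  rw [apolarPairing_monomial]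
  exact mul_pos (Finset.prod_pos fun x _ => Nat.cast_pos.2 (Nat.factorial_pos _))
    (coeff_auxTrace_pos_iff.2 ⟨⟨i, h⟩, rfl⟩)

theorem isClosedChoice_of_choiceTerm_ne_zero (h : choiceTerm E k α Q ≠ 0) :
    IsClosedChoice E k Q := by
  obtain ⟨hcoeff, hpairing⟩ := mul_ne_zero_iff.1 (mul_ne_zero_iff.1 h).2
  refine ⟨fun i e hie => ?_,
    exists_isArcWalk_of_coeff_auxTrace_ne_zero (apolarPairing_auxTrace_ne_zero_iff.1 hpairing)⟩
  have hrow := (mul_ne_zero_iff.1 (Finset.prod_ne_zero_iff.1 hcoeff i (Finset.mem_univ i))).2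
  have hterm := Finset.prod_ne_zero_iff.1 hrow (some e) (Finset.mem_univ _)
  by_contra hmem
  exact hterm (by simp [termCoeff, hmem, hie])

theorem sum_loopChoice (i : ι) (d : ℕ) (j : ι) :
    ∑ o, loopChoice i d j o = if j = i then d else 0 := by
  simp [Fintype.sum_option, loopChoice]

theorem loopChoice_mem_choices (i : ι) (d : ℕ) : loopChoice i d ∈ choices ι d := by
  simp only [mem_choices, sum_loopChoice, Finset.sum_ite_eq', Finset.mem_univ, if_true]

theorem sum_edgeChoice (e : Finset ι) (l : ι → ℕ) (i : ι) :
    ∑ o, edgeChoice e l i o = l i + if i ∈ e then 1 else 0 := by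
  simp [Fintype.sum_option, edgeChoice, ite_and]

theorem edgeChoice_mem_choices_iff {e : Finset ι} {l : ι → ℕ} {r : ℕ} (he : e.card = k)
    (hl : ∀ i, l i ≠ 0 → i ∈ e) : edgeChoice e l ∈ choices ι (k + r) ↔ l ∈ e.piAntidiag r := by
  have hsum : ∑ i, l i = ∑ i ∈ e, l i :=
    (Finset.sum_subset (Finset.subset_univ e) fun i _ hi => by_contra fun h => hi (hl i h)).symm
  simp only [mem_choices, sum_edgeChoice, Finset.sum_add_distrib, Finset.mem_piAntidiag, hsum]
  simp only [Finset.sum_ite_mem, Finset.univ_inter, Finset.sum_const, smul_eq_mul, mul_one, he]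
  exact ⟨fun h => ⟨by lia, hl⟩, fun h => by lia⟩

theorem sum_choices_filter_loop (hk : 2 ≤ k) (hd : d ≠ 0) :
    ∑ Q ∈ choices ι d with ∀ i e, Q i (some e) = 0, choiceTerm E k α Q =
      ∑ i, choiceTerm E k α (loopChoice i d) := by
  refine (Finset.sum_of_injOn (loopChoice · d) ?_ ?_ ?_ fun _ _ => rfl).symm
  · intro i _ j _ hij
    by_contra hne
    have := congrFun (congrFun hij i) none
    simp [loopChoice, hne, hd] at this
  · exact fun i _ => Finset.mem_filter.2 ⟨loopChoice_mem_choices i d, fun _ _ => rfl⟩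
  · intro Q hQ hloop
    obtain ⟨hmem, hsome⟩ := Finset.mem_filter.1 hQ
    by_contra h
    obtain ⟨i, d', rfl⟩ := (isClosedChoice_of_choiceTerm_ne_zero h).exists_eq_loopChoice hk hsome
    obtain rfl : d' = d := by
      simpa only [mem_choices, sum_loopChoice, Finset.sum_ite_eq', Finset.mem_univ, if_true]
        using hmem
    exact hloop ⟨i, Finset.mem_coe.2 (Finset.mem_univ i), rfl⟩

theorem exists_eq_edgeChoice_of_choiceTerm_ne_zero (hE : IsLinearUniform E k) (hk : 3 ≤ k)
    (hd : d ≤ k + 2) (hQ : Q ∈ choices ι d) (hsome : ¬∀ i e, Q i (some e) = 0)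
    (h : choiceTerm E k α Q ≠ 0) :
    ∃ e ∈ E, ∃ l : ι → ℕ, (∀ i, l i ≠ 0 → i ∈ e) ∧ Q = edgeChoice e l :=
  ((isClosedChoice_of_choiceTerm_ne_zero h).eq_loopChoice_or_edgeChoice hE hk
    ((mem_choices.1 hQ).trans_le hd)).resolve_left fun ⟨_, _, hQ⟩ => hsome fun _ _ => by
      rw [hQ, loopChoice]

theorem sum_choices_filter_edge_of_lt (hE : IsLinearUniform E k) (hk : 3 ≤ k) (hd : d < k) :
    ∑ Q ∈ choices ι d with ¬∀ i e, Q i (some e) = 0, choiceTerm E k α Q = 0 := by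
  refine Finset.sum_eq_zero fun Q hQ => ?_
  obtain ⟨hmem, hsome⟩ := Finset.mem_filter.1 hQ
  by_contra h
  obtain ⟨e, he, l, -, rfl⟩ :=
    exists_eq_edgeChoice_of_choiceTerm_ne_zero hE hk (by lia) hmem hsome h
  simp only [mem_choices, sum_edgeChoice, Finset.sum_add_distrib, Finset.sum_ite_mem,
    Finset.univ_inter, Finset.sum_const, smul_eq_mul, mul_one, hE.card_eq e he] at hmem
  lia

theorem sum_choices_filter_edge (hE : IsLinearUniform E k) (hk : 3 ≤ k) {r : ℕ} (hr : r ≤ 2) :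
    ∑ Q ∈ choices ι (k + r) with ¬∀ i e, Q i (some e) = 0, choiceTerm E k α Q =
      ∑ e ∈ E, ∑ l ∈ e.piAntidiag r, choiceTerm E k α (edgeChoice e l) := by
  have hnonempty (e) (he : e ∈ E) : e.Nonempty := by
    rw [← Finset.card_pos, hE.card_eq e he]
    lia
  rw [Finset.sum_sigma']
  refine (Finset.sum_of_injOn (fun x => edgeChoice x.1 x.2) ?_ ?_ ?_ ?_).symm
  · rintro ⟨e, l⟩ hel ⟨f, l'⟩ - h
    have he := (Finset.mem_sigma.1 (Finset.mem_coe.1 hel)).1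
    obtain ⟨rfl, rfl⟩ := edgeChoice_injective (hnonempty e he) h
    rfl
  · rintro ⟨e, l⟩ hel
    obtain ⟨he, hl⟩ := Finset.mem_sigma.1 (Finset.mem_coe.1 hel)
    refine Finset.mem_filter.2 ⟨(edgeChoice_mem_choices_iff (hE.card_eq e he)
      (Finset.mem_piAntidiag.1 hl).2).2 hl, fun h => ?_⟩
    obtain ⟨i, hi⟩ := hnonempty e he
    have := h i e
    simp [edgeChoice, hi] at this
  · intro Q hQ hedge
    obtain ⟨hmem, hsome⟩ := Finset.mem_filter.1 hQ
    by_contra h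
    obtain ⟨e, he, l, hl, rfl⟩ :=
      exists_eq_edgeChoice_of_choiceTerm_ne_zero hE hk (by lia) hmem hsome h
    rw [edgeChoice_mem_choices_iff (hE.card_eq e he) hl] at hmem
    exact hedge ⟨⟨e, l⟩, Finset.mem_coe.2 (Finset.mem_sigma.2 ⟨he, hmem⟩), rfl⟩
  · intro x _
    rfl

end Choices

section Weights

open MvPolynomial
open Finsupp (single)

variable {ι : Type*} [DecidableEq ι] [Fintype ι] {E : Finset (Finset ι)} {k : ℕ} {e f : Finset ι}
  {l : ι → ℕ}

theorem productArcs_loopChoice (k : ℕ) (i : ι) (d : ℕ) :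
    productArcs k (loopChoice i d) = single (i, i) (d * (k - 1)) := by
  simp [productArcs, Fintype.sum_option, loopChoice, termArcs, ite_smul, -Finsupp.single_mul,
    -Finsupp.single_tsub]

theorem productCoeff_loopChoice (E : Finset (Finset ι)) (α : ℝ) (i : ι) (d : ℕ) :
    productCoeff E α (loopChoice i d) = (α * familyDegree E i) ^ d := by
  rw [productCoeff, Fintype.prod_eq_single i fun j hj => by
    simp [Nat.multinomial, Fintype.sum_option, Fintype.prod_option, loopChoice, hj]]
  simp [Nat.multinomial, Fintype.sum_option, Fintype.prod_option, loopChoice, termCoeff,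
    Nat.div_self (Nat.factorial_pos _)]

theorem productArcs_edgeChoice (k : ℕ) (hl : ∀ i, l i ≠ 0 → i ∈ e) :
    productArcs k (edgeChoice e l) = completeArcs e fun i => l i * (k - 1) := by
  rw [productArcs, completeArcs, ← Finset.sum_subset (Finset.subset_univ e)]
  · refine Finset.sum_congr rfl fun i hi => ?_
    rw [Fintype.sum_option, Fintype.sum_eq_single e fun f hf => by simp [edgeChoice, hf]]
    simp [edgeChoice, termArcs, hi, -Finsupp.single_mul, -Finsupp.single_tsub]
  · intro i _ hi
    have : l i = 0 := by_contra fun h => hi (hl i h)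
    simp [Fintype.sum_option, edgeChoice, this, hi]

theorem multinomial_edgeChoice {i : ι} (hi : i ∈ e) (l : ι → ℕ) :
    Nat.multinomial Finset.univ (edgeChoice e l i) = l i + 1 := by
  rw [Nat.multinomial, sum_edgeChoice, Fintype.prod_option]
  simp only [edgeChoice, hi, and_true, if_true, apply_ite Nat.factorial, Nat.factorial_one,
    Nat.factorial_zero, ite_self, Finset.prod_const_one, mul_one]
  rw [Nat.factorial_succ, Nat.mul_div_cancel _ (Nat.factorial_pos _)]

theorem productCoeff_edgeChoice (α : ℝ) (he : e ∈ E) (hl : ∀ i, l i ≠ 0 → i ∈ e) :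
    productCoeff E α (edgeChoice e l) =
      ∏ i ∈ e, ((l i + 1 : ℕ) * ((α * familyDegree E i) ^ l i * (1 - α))) := by
  rw [productCoeff, ← Finset.prod_subset (Finset.subset_univ e)]
  · refine Finset.prod_congr rfl fun i hi => ?_
    rw [multinomial_edgeChoice hi, Fintype.prod_option,
      Fintype.prod_eq_single e fun f hf => by simp [edgeChoice, hf]]
    simp [edgeChoice, termCoeff, he, hi]
  · intro i _ hi
    have : l i = 0 := by_contra fun h => hi (hl i h)
    simp [Nat.multinomial, Fintype.sum_option, edgeChoice, this, hi]

/-- The contribution of the loops at `i` to the trace of order `d`, up to the factor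
`(α * deg i) ^ d`. -/
noncomputable def loopWeight (k d : ℕ) (i : ι) : ℝ :=
  1 / ((d * (k - 1))! : ℝ) *
    apolarPairing (monomial (single (i, i) (d * (k - 1))) 1) (auxTrace ι (d * (k - 1)))

/-- The contribution of the hyperedge `e` with `l i` loops at each vertex `i` to the traces, up to
a product of powers of degrees. -/
noncomputable def edgeWeight (k : ℕ) (α : ℝ) (e : Finset ι) (l : ι → ℕ) : ℝ :=
  (∏ i ∈ e, (1 / (((l i + 1) * (k - 1))! : ℝ) * ((l i + 1 : ℕ) * (α ^ l i * (1 - α))))) *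
    apolarPairing (monomial (completeArcs e fun i => l i * (k - 1)) 1)
      (auxTrace ι ((∑ i ∈ e, (l i + 1)) * (k - 1)))

theorem choiceTerm_loopChoice (E : Finset (Finset ι)) (k : ℕ) (α : ℝ) (i : ι) (d : ℕ) :
    choiceTerm E k α (loopChoice i d) = loopWeight k d i * (α * familyDegree E i) ^ d := by
  simp only [choiceTerm, sum_loopChoice, productCoeff_loopChoice, productArcs_loopChoice,
    Finset.sum_ite_eq', Finset.mem_univ, if_true]
  rw [Fintype.prod_eq_single i fun j hj => by simp [hj], if_pos rfl, loopWeight]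
  ring

theorem choiceTerm_edgeChoice (k : ℕ) (α : ℝ) (he : e ∈ E) (hl : ∀ i, l i ≠ 0 → i ∈ e) :
    choiceTerm E k α (edgeChoice e l) =
      edgeWeight k α e l * ∏ i ∈ e, (familyDegree E i : ℝ) ^ l i := by
  have hout (i) (_ : i ∈ Finset.univ) (hi : i ∉ e) : l i + (if i ∈ e then 1 else 0) = 0 := by
    rw [if_neg hi, add_zero]
    exact by_contra fun h => hi (hl i h)
  simp only [choiceTerm, sum_edgeChoice, productCoeff_edgeChoice α he hl,
    productArcs_edgeChoice k hl, edgeWeight]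
  rw [← Finset.prod_subset (Finset.subset_univ e) fun i h hi => by simp [hout i h hi],
    ← Finset.sum_subset (Finset.subset_univ e) fun i h hi => hout i h hi,
    Finset.sum_congr rfl fun i hi => by rw [if_pos hi],
    Finset.prod_congr rfl fun i hi => by rw [if_pos hi]]
  simp only [mul_pow, Finset.prod_mul_distrib]
  ring

theorem trace_familyTensor_of_lt (hE : IsLinearUniform E k) (hk : 3 ≤ k) (α : ℝ) {d : ℕ}
    (hd : d ≠ 0) (hdk : d < k) :
    (familyTensor E k α).trace d = ((k : ℝ) - 1) ^ (Fintype.card ι - 1) *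
      ∑ i, loopWeight k d i * (α * familyDegree E i) ^ d := by
  rw [trace_familyTensor_eq_sum_choiceTerm (by lia) hE.card_eq,
    ← Finset.sum_filter_add_sum_filter_not _ fun Q => ∀ i e, Q i (some e) = 0,
    sum_choices_filter_loop (by lia) hd, sum_choices_filter_edge_of_lt hE hk hdk, add_zero]
  simp only [choiceTerm_loopChoice]

theorem trace_familyTensor_add (hE : IsLinearUniform E k) (hk : 3 ≤ k) (α : ℝ) {r : ℕ}
    (hr : r ≤ 2) :
    (familyTensor E k α).trace (k + r) = ((k : ℝ) - 1) ^ (Fintype.card ι - 1) *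
      (∑ i, loopWeight k (k + r) i * (α * familyDegree E i) ^ (k + r) +
        ∑ e ∈ E, ∑ l ∈ e.piAntidiag r,
          edgeWeight k α e l * ∏ i ∈ e, (familyDegree E i : ℝ) ^ l i) := by
  rw [trace_familyTensor_eq_sum_choiceTerm (by lia) hE.card_eq,
    ← Finset.sum_filter_add_sum_filter_not _ fun Q => ∀ i e, Q i (some e) = 0,
    sum_choices_filter_loop (by lia) (by lia), sum_choices_filter_edge hE hk hr]
  simp only [choiceTerm_loopChoice]
  congr 2
  exact Finset.sum_congr rfl fun e he => Finset.sum_congr rfl fun l hl =>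
    choiceTerm_edgeChoice k α he (Finset.mem_piAntidiag.1 hl).2

end Weights

end RTensor

section PiAntidiag

variable {ι : Type*} [DecidableEq ι] {s : Finset ι}

theorem add_single_mem_piAntidiag_succ_iff {u : ι} (hu : u ∈ s) {r : ℕ} {l : ι → ℕ} :
    l + Pi.single u 1 ∈ s.piAntidiag (r + 1) ↔ l ∈ s.piAntidiag r := by
  have hsum : ∑ i ∈ s, (l + Pi.single u 1 : ι → ℕ) i = ∑ i ∈ s, l i + 1 := by
    simp only [Pi.add_apply, Finset.sum_add_distrib]
    rw [Finset.sum_eq_single_of_mem (f := Pi.single u 1) u hu fun i _ hi =>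
      Pi.single_eq_of_ne hi 1, Pi.single_eq_same]
  rw [Finset.mem_piAntidiag, Finset.mem_piAntidiag]
  refine and_congr (hsum ▸ add_left_inj 1) (forall_congr' fun i => ?_)
  obtain rfl | hi := eq_or_ne i u
  · simp [hu]
  · simp [hi]

/-- Double count the pairs of `l` and one of the `r + 1` units of `l`. -/
theorem succ_nsmul_sum_piAntidiag_succ {M : Type*} [AddCommMonoid M] (s : Finset ι) (r : ℕ)
    (F : (ι → ℕ) → M) :
    (r + 1) • ∑ l ∈ s.piAntidiag (r + 1), F l =
      ∑ u ∈ s, ∑ l ∈ s.piAntidiag r, (l u + 1) • F (l + Pi.single u 1) := by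
  have hcount : (r + 1) • ∑ l ∈ s.piAntidiag (r + 1), F l =
      ∑ u ∈ s, ∑ l ∈ s.piAntidiag (r + 1), l u • F l := by
    rw [Finset.sum_comm, Finset.smul_sum]
    refine Finset.sum_congr rfl fun l hl => ?_
    rw [Finset.sum_nsmul_assoc, (Finset.mem_piAntidiag.1 hl).1]
  rw [hcount]
  refine Finset.sum_congr rfl fun u hu => (Finset.sum_of_injOn (· + Pi.single u 1)
    (fun _ _ _ _ h => add_right_cancel h)
    (fun l hl => (add_single_mem_piAntidiag_succ_iff hu).2 hl) ?_ fun l _ => by simp).symm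
  intro l hl hne
  have hlu : l u = 0 := by
    by_contra h
    have hl' : l - Pi.single u 1 + Pi.single u 1 = l := funext fun i => by
      obtain rfl | hi := eq_or_ne i u
      · simpa using Nat.sub_add_cancel (Nat.pos_of_ne_zero h)
      · simp [hi]
    exact hne ⟨_, (add_single_mem_piAntidiag_succ_iff hu).1 (hl'.symm ▸ hl), hl'⟩
  rw [hlu, zero_smul]

theorem sum_piAntidiag_one {M : Type*} [AddCommMonoid M] (s : Finset ι) (F : (ι → ℕ) → M) :
    ∑ l ∈ s.piAntidiag 1, F l = ∑ u ∈ s, F (Pi.single u 1) := by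
  simpa using succ_nsmul_sum_piAntidiag_succ s 0 F

theorem prod_pow_single {R : Type*} [CommMonoid R] {u : ι} (hu : u ∈ s) (x : ι → R) (n : ℕ) :
    ∏ i ∈ s, x i ^ (Pi.single u n : ι → ℕ) i = x u ^ n := by
  rw [Finset.prod_eq_single_of_mem u hu fun i _ hi => by simp [hi], Pi.single_eq_same]

theorem sum_piAntidiag_two_mul_prod_pow {W : (ι → ℕ) → ℝ} {A B : ℝ} (x : ι → ℝ)
    (hA : ∀ a ∈ s, W (Pi.single a 2) = A)
    (hB : ∀ a ∈ s, ∀ b ∈ s, a ≠ b → W (Pi.single a 1 + Pi.single b 1) = B) :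
    ∑ l ∈ s.piAntidiag 2, W l * ∏ i ∈ s, x i ^ l i =
      (A - B / 2) * ∑ v ∈ s, x v ^ 2 + B / 2 * (∑ v ∈ s, x v) ^ 2 := by
  have hdouble := succ_nsmul_sum_piAntidiag_succ s 1 fun l => W l * ∏ i ∈ s, x i ^ l i
  have hterm (u) (hu : u ∈ s) (v) (hv : v ∈ s) :
      ((Pi.single v 1 : ι → ℕ) u + 1) • (W (Pi.single v 1 + Pi.single u 1) *
        ∏ i ∈ s, x i ^ (Pi.single v 1 + Pi.single u 1 : ι → ℕ) i) =
      B * (x u * x v) + if v = u then (2 * A - B) * x u ^ 2 else 0 := by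
    simp only [Pi.add_apply, pow_add, Finset.prod_mul_distrib, prod_pow_single hu,
      prod_pow_single hv, pow_one]
    obtain rfl | hvu := eq_or_ne v u
    · rw [← Pi.single_add, hA v hv, Pi.single_eq_same, if_pos rfl, two_nsmul]
      ring
    · rw [hB v hv u hu hvu, Pi.single_eq_of_ne hvu.symm, if_neg hvu]
      ring
  simp only [sum_piAntidiag_one] at hdouble
  rw [Finset.sum_congr rfl fun u hu => Finset.sum_congr rfl (hterm u hu)] at hdouble
  simp only [Finset.sum_add_distrib, ← Finset.mul_sum, ← Finset.sum_mul, Finset.sum_ite_eq']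
    at hdouble
  rw [Finset.sum_congr rfl fun u (hu : u ∈ s) => if_pos hu, ← Finset.mul_sum, two_nsmul]
    at hdouble
  linarith

end PiAntidiag

theorem exists_perm_map_eq {ι : Type*} [Finite ι] {s t : Finset ι}
    (h : s.card = t.card) {a b c d : ι} (ha : a ∈ s) (hb : b ∈ s) (hab : a ≠ b) (hc : c ∈ t)
    (hd : d ∈ t) (hcd : c ≠ d) :
    ∃ σ : Equiv.Perm ι, s.map σ.toEmbedding = t ∧ σ a = c ∧ σ b = d := by
  classical
  obtain ⟨g, hg⟩ := Finset.exists_equiv_extend_of_card_eq (α := s) (t := t)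
    (s := {⟨a, ha⟩, ⟨b, hb⟩}) (f := fun x => if (x : ι) = a then c else d)
    ((Fintype.card_coe s).trans h) (by simp [Finset.insert_subset_iff, hc, hd, hab.symm])
    (by simp [hcd, hab.symm])
  have hga : (g ⟨a, ha⟩ : ι) = c := by simpa using hg ⟨a, ha⟩ (by simp)
  have hgb : (g ⟨b, hb⟩ : ι) = d := by simpa [hab.symm] using hg ⟨b, hb⟩ (by simp)
  refine ⟨g.extendSubtype, Finset.eq_of_subset_of_card_le (fun x hx => ?_)
    (by rw [Finset.card_map, h]), (g.extendSubtype_apply_of_mem a ha).trans hga,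
    (g.extendSubtype_apply_of_mem b hb).trans hgb⟩
  obtain ⟨y, hy, rfl⟩ := Finset.mem_map.1 hx
  exact g.extendSubtype_mem y hy

namespace RTensor

section Symmetry

open MvPolynomial
open Finsupp (single)

variable {ι : Type*} [DecidableEq ι]

theorem mapDomain_completeArcs (σ : Equiv.Perm ι) (s : Finset ι) (l : ι → ℕ) :
    (completeArcs s (l ∘ σ)).mapDomain (σ.prodCongr σ) =
      completeArcs (s.map σ.toEmbedding) l := by
  simp only [completeArcs, Finsupp.mapDomain_finsetSum, Finsupp.mapDomain_add,
    Finsupp.mapDomain_single, Finset.sum_map, Equiv.prodCongr_apply, Prod.map, Function.comp_apply,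
    Equiv.coe_toEmbedding]
  refine Finset.sum_congr rfl fun i _ => ?_
  congr 1
  rw [← Equiv.coe_toEmbedding σ, ← Finset.map_erase, Finset.sum_map]

theorem degree_completeArcs (s : Finset ι) (l : ι → ℕ) :
    (completeArcs s l).degree = ∑ i ∈ s, (l i + (s.card - 1)) := by
  simp only [completeArcs, map_sum, map_add, Finsupp.degree_single, Finset.sum_const, smul_eq_mul,
    mul_one]
  exact Finset.sum_congr rfl fun i hi => by rw [Finset.card_erase_of_mem hi]

variable [Fintype ι]

theorem apolarPairing_auxTrace_mapDomain (σ : Equiv.Perm ι) (N : ℕ) (M : ι × ι →₀ ℕ) :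
    apolarPairing (monomial (M.mapDomain (σ.prodCongr σ)) 1) (auxTrace ι N) =
      apolarPairing (monomial M 1) (auxTrace ι N) := by
  rw [← apolarPairing_rename (σ.prodCongr σ) (monomial M 1), rename_auxTrace, rename_monomial]

theorem loopWeight_eq (k d : ℕ) (i j : ι) : loopWeight k d i = loopWeight k d j := by
  rw [loopWeight, loopWeight, ← apolarPairing_auxTrace_mapDomain (Equiv.swap i j),
    Finsupp.mapDomain_single]
  simp

theorem loopWeight_pos (k d : ℕ) (i : ι) : 0 < loopWeight k d i := by
  have h := apolarPairing_auxTrace_pos (IsArcWalk.loops i (d * (k - 1)))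
  rw [Finsupp.degree_single] at h
  exact mul_pos (by positivity) h

theorem edgeWeight_map (k : ℕ) (α : ℝ) (σ : Equiv.Perm ι) (e : Finset ι) (l : ι → ℕ) :
    edgeWeight k α (e.map σ.toEmbedding) l = edgeWeight k α e (l ∘ σ) := by
  rw [edgeWeight, edgeWeight, ← mapDomain_completeArcs, apolarPairing_auxTrace_mapDomain]
  simp only [Finset.prod_map, Finset.sum_map, Equiv.coe_toEmbedding, Function.comp_def]

variable {k : ℕ} {α : ℝ} {e f : Finset ι}

theorem edgeWeight_pos (he : e.card = k) (hk : 1 ≤ k) (hα₀ : 0 < α) (hα₁ : α < 1) (l : ι → ℕ) :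
    0 < edgeWeight k α e l := by
  obtain ⟨b, hb⟩ : e.Nonempty := by
    rw [← Finset.card_pos, he]
    lia
  have hpairing := apolarPairing_auxTrace_pos (isArcWalk_completeArcs hb fun i => l i * (k - 1))
  rw [degree_completeArcs, he] at hpairing
  refine mul_pos (Finset.prod_pos fun i _ => ?_) ?_
  · have := sub_pos.2 hα₁
    positivity
  · simpa only [Finset.sum_mul, add_one_mul] using hpairing

theorem edgeWeight_single_add_single_eq (h : e.card = f.card) {a b c d : ι} (ha : a ∈ e)
    (hb : b ∈ e) (hab : a ≠ b) (hc : c ∈ f) (hd : d ∈ f) (hcd : c ≠ d) (k p q : ℕ) (α : ℝ) :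
    edgeWeight k α e (Pi.single a p + Pi.single b q) =
      edgeWeight k α f (Pi.single c p + Pi.single d q) := by
  obtain ⟨σ, rfl, rfl, rfl⟩ := exists_perm_map_eq h ha hb hab hc hd hcd
  rw [edgeWeight_map]
  congr 1
  funext x
  simp [Pi.single_apply]

theorem exists_edgeWeight_single_add_single_eq (ι : Type*) [Fintype ι] [DecidableEq ι]
    (hk : 1 ≤ k) (hα₀ : 0 < α) (hα₁ : α < 1) (p q : ℕ) :
    ∃ A, 0 < A ∧ ∀ (e : Finset ι) (a b : ι), e.card = k → a ∈ e → b ∈ e → a ≠ b →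
      edgeWeight k α e (Pi.single a p + Pi.single b q) = A := by
  by_cases h : ∃ (e : Finset ι) (a b : ι), e.card = k ∧ a ∈ e ∧ b ∈ e ∧ a ≠ b
  · obtain ⟨e, a, b, he, ha, hb, hab⟩ := h
    exact ⟨_, edgeWeight_pos he hk hα₀ hα₁ _, fun f c d hf hc hd hcd =>
      edgeWeight_single_add_single_eq (hf.trans he.symm) hc hd hcd ha hb hab k p q α⟩
  · exact ⟨1, one_pos, fun e a b he ha hb hab => absurd ⟨e, a, b, he, ha, hb, hab⟩ h⟩

theorem exists_edgeWeight_single_eq (ι : Type*) [Fintype ι] [DecidableEq ι] (hk : 2 ≤ k)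
    (hα₀ : 0 < α) (hα₁ : α < 1) (p : ℕ) :
    ∃ A, ∀ (e : Finset ι) (a : ι), e.card = k → a ∈ e → edgeWeight k α e (Pi.single a p) = A := by
  obtain ⟨A, -, h⟩ := exists_edgeWeight_single_add_single_eq (k := k) ι (by lia) hα₀ hα₁ p 0
  refine ⟨A, fun e a he ha => ?_⟩
  obtain ⟨b, hb, hba⟩ := Finset.exists_mem_ne (show 1 < e.card by lia) a
  rw [← h e a b he ha hb hba.symm, Pi.single_zero, add_zero]

theorem exists_sum_loopWeight_eq (ι : Type*) [Fintype ι] [DecidableEq ι] (hk : 2 ≤ k)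
    (hα₀ : 0 < α) (d : ℕ) :
    ∃ c : ℝ, 0 < c ∧ ∀ E : Finset (Finset ι), ((k : ℝ) - 1) ^ (Fintype.card ι - 1) *
      ∑ i, loopWeight k d i * (α * familyDegree E i) ^ d =
        c * ∑ i, (familyDegree E i : ℝ) ^ d := by
  obtain hι | ⟨⟨j⟩⟩ := isEmpty_or_nonempty ι
  · exact ⟨1, one_pos, fun E => by simp⟩
  have hk' : (0 : ℝ) < k - 1 := sub_pos.2 (by exact_mod_cast hk)
  refine ⟨((k : ℝ) - 1) ^ (Fintype.card ι - 1) * (loopWeight k d j * α ^ d),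
    mul_pos (pow_pos hk' _) (mul_pos (loopWeight_pos k d j) (pow_pos hα₀ d)), fun E => ?_⟩
  simp only [loopWeight_eq k d _ j, mul_pow, ← mul_assoc, ← Finset.mul_sum]

end Symmetry

end RTensor

namespace RTensor

section TraceFormulas

variable {ι : Type*} [DecidableEq ι]

theorem sum_sum_mem_eq_sum_familyDegree_mul [Fintype ι] (E : Finset (Finset ι)) (f : ι → ℝ) :
    ∑ e ∈ E, ∑ v ∈ e, f v = ∑ v, familyDegree E v * f v := by
  rw [Finset.sum_comm' (t' := Finset.univ) (s' := fun v => E.filter fun e => v ∈ e) (by simp)]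
  simp only [Finset.sum_const, nsmul_eq_mul, familyDegree]

variable [Fintype ι] {k : ℕ} {α : ℝ}

theorem exists_trace_familyTensor_eq_of_lt (ι : Type*) [Fintype ι] [DecidableEq ι] (hk : 3 ≤ k)
    (hα₀ : 0 < α) {d : ℕ} (hd : d ≠ 0) (hdk : d < k) :
    ∃ c : ℝ, 0 < c ∧ ∀ E : Finset (Finset ι), IsLinearUniform E k →
      (familyTensor E k α).trace d = c * ∑ i, (familyDegree E i : ℝ) ^ d := by
  obtain ⟨c, hc, h⟩ := exists_sum_loopWeight_eq (k := k) ι (by lia) hα₀ d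
  exact ⟨c, hc, fun E hE => (trace_familyTensor_of_lt hE hk α hd hdk).trans (h E)⟩

theorem exists_sum_edgeWeight_zero_eq (ι : Type*) [Fintype ι] [DecidableEq ι] (hk : 2 ≤ k)
    (hα₀ : 0 < α) (hα₁ : α < 1) :
    ∃ b : ℝ, ∀ (e : Finset ι) (x : ι → ℝ), e.card = k →
      ∑ l ∈ e.piAntidiag 0, edgeWeight k α e l * ∏ i ∈ e, x i ^ l i = b * ∑ _ ∈ e, 1 := by
  obtain ⟨A, hA⟩ := exists_edgeWeight_single_eq ι hk hα₀ hα₁ 0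
  refine ⟨A / k, fun e x he => ?_⟩
  obtain ⟨a, ha⟩ : e.Nonempty := Finset.card_pos.1 (by lia)
  have hk' : (k : ℝ) ≠ 0 := Nat.cast_ne_zero.2 (by lia)
  simp [← hA e a he ha, he, hk']

theorem exists_sum_edgeWeight_one_eq (ι : Type*) [Fintype ι] [DecidableEq ι] (hk : 2 ≤ k)
    (hα₀ : 0 < α) (hα₁ : α < 1) :
    ∃ b : ℝ, ∀ (e : Finset ι) (x : ι → ℝ), e.card = k →
      ∑ l ∈ e.piAntidiag 1, edgeWeight k α e l * ∏ i ∈ e, x i ^ l i = b * ∑ i ∈ e, x i := by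
  obtain ⟨A, hA⟩ := exists_edgeWeight_single_eq ι hk hα₀ hα₁ 1
  refine ⟨A, fun e x he => ?_⟩
  rw [sum_piAntidiag_one, Finset.mul_sum]
  refine Finset.sum_congr rfl fun u hu => ?_
  rw [prod_pow_single hu, pow_one, hA e u he hu]

theorem exists_sum_edgeWeight_two_eq (ι : Type*) [Fintype ι] [DecidableEq ι] (hk : 2 ≤ k)
    (hα₀ : 0 < α) (hα₁ : α < 1) :
    ∃ b c : ℝ, 0 < c ∧ ∀ (e : Finset ι) (x : ι → ℝ), e.card = k →
      ∑ l ∈ e.piAntidiag 2, edgeWeight k α e l * ∏ i ∈ e, x i ^ l i =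
        b * ∑ i ∈ e, x i ^ 2 + c * (∑ i ∈ e, x i) ^ 2 := by
  obtain ⟨A, hA⟩ := exists_edgeWeight_single_eq ι hk hα₀ hα₁ 2
  obtain ⟨B, hB, hAB⟩ :=
    exists_edgeWeight_single_add_single_eq (k := k) ι (by lia) hα₀ hα₁ 1 1
  exact ⟨A - B / 2, B / 2, half_pos hB, fun e x he => sum_piAntidiag_two_mul_prod_pow x
    (fun a ha => hA e a he ha) fun a ha b hb hab => hAB e a b he ha hb hab⟩

theorem exists_trace_familyTensor_add_eq (ι : Type*) [Fintype ι] [DecidableEq ι] (hk : 3 ≤ k)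
    (hα₀ : 0 < α) (hα₁ : α < 1) {r : ℕ} (hr : r < 2) :
    ∃ a b : ℝ, ∀ E : Finset (Finset ι), IsLinearUniform E k →
      (familyTensor E k α).trace (k + r) =
        a * ∑ i, (familyDegree E i : ℝ) ^ (k + r) + b * ∑ i, (familyDegree E i : ℝ) ^ (r + 1) := by
  obtain ⟨a, -, ha⟩ := exists_sum_loopWeight_eq (k := k) ι (by lia) hα₀ (k + r)
  obtain ⟨b, hb⟩ : ∃ b : ℝ, ∀ (e : Finset ι) (x : ι → ℝ), e.card = k →
      ∑ l ∈ e.piAntidiag r, edgeWeight k α e l * ∏ i ∈ e, x i ^ l i = b * ∑ i ∈ e, x i ^ r := by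
    obtain rfl | rfl := Nat.le_one_iff_eq_zero_or_eq_one.1 (Nat.le_of_lt_succ hr)
    · simpa only [pow_zero] using exists_sum_edgeWeight_zero_eq ι (by lia) hα₀ hα₁
    · simpa only [pow_one] using exists_sum_edgeWeight_one_eq ι (by lia) hα₀ hα₁
  refine ⟨a, ((k : ℝ) - 1) ^ (Fintype.card ι - 1) * b, fun E hE => ?_⟩
  rw [trace_familyTensor_add hE hk α hr.le, mul_add, ha E,
    Finset.sum_congr rfl fun e he => hb e _ (hE.card_eq e he), ← Finset.mul_sum, ← mul_assoc,
    sum_sum_mem_eq_sum_familyDegree_mul]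
  simp only [pow_succ']

theorem exists_trace_familyTensor_add_two_eq (ι : Type*) [Fintype ι] [DecidableEq ι] (hk : 3 ≤ k)
    (hα₀ : 0 < α) (hα₁ : α < 1) :
    ∃ a b c : ℝ, 0 < c ∧ ∀ E : Finset (Finset ι), IsLinearUniform E k →
      (familyTensor E k α).trace (k + 2) =
        a * ∑ i, (familyDegree E i : ℝ) ^ (k + 2) + b * ∑ i, (familyDegree E i : ℝ) ^ 3 +
          c * ∑ e ∈ E, (∑ i ∈ e, (familyDegree E i : ℝ)) ^ 2 := by
  obtain ⟨a, -, ha⟩ := exists_sum_loopWeight_eq (k := k) ι (by lia) hα₀ (k + 2)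
  obtain ⟨b, c, hc, hbc⟩ := exists_sum_edgeWeight_two_eq (k := k) ι (by lia) hα₀ hα₁
  have hk' : (0 : ℝ) < k - 1 := sub_pos.2 (by exact_mod_cast (by lia : 1 < k))
  refine ⟨a, ((k : ℝ) - 1) ^ (Fintype.card ι - 1) * b,
    ((k : ℝ) - 1) ^ (Fintype.card ι - 1) * c, by positivity, fun E hE => ?_⟩
  rw [trace_familyTensor_add hE hk α le_rfl, mul_add, ha E,
    Finset.sum_congr rfl fun e he => hbc e _ (hE.card_eq e he), Finset.sum_add_distrib,
    ← Finset.mul_sum, ← Finset.mul_sum, sum_sum_mem_eq_sum_familyDegree_mul]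
  simp only [← pow_succ']
  ring

end TraceFormulas

section Comparison

theorem sum_sq_lt_sum_sq_of_sum_eq {κ κ' : Type*} {s : Finset κ} {t : Finset κ'} {x : κ → ℝ}
    {y : κ' → ℝ} {c : ℝ} (hcard : s.card = t.card) (hsum : ∑ i ∈ s, x i = ∑ j ∈ t, y j)
    (hx : ∀ i ∈ s, x i = c) (hy : ∃ j ∈ t, y j ≠ c) : ∑ i ∈ s, x i ^ 2 < ∑ j ∈ t, y j ^ 2 := by
  obtain ⟨j, hj, hne⟩ := hy
  have hpos : 0 < ∑ j ∈ t, (y j - c) ^ 2 :=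
    Finset.sum_pos' (fun _ _ => sq_nonneg _) ⟨j, hj, by have := sub_ne_zero.2 hne; positivity⟩
  have hs : ∑ i ∈ s, x i ^ 2 = 2 * c * ∑ i ∈ s, x i - s.card * c ^ 2 := by
    rw [Finset.sum_congr rfl hx, Finset.sum_congr rfl fun i hi => by rw [hx i hi],
      Finset.sum_const, Finset.sum_const, nsmul_eq_mul, nsmul_eq_mul]
    ring
  have ht : ∑ j ∈ t, (y j - c) ^ 2 =
      ∑ j ∈ t, y j ^ 2 - 2 * c * ∑ j ∈ t, y j + t.card * c ^ 2 := by
    simp only [sub_sq, Finset.sum_add_distrib, Finset.sum_sub_distrib, Finset.mul_sum,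
      Finset.sum_const, nsmul_eq_mul]
    simp only [mul_right_comm]
  rw [hs, hsum, hcard]
  linarith

variable {ι : Type*} [Fintype ι]

/-- No positive integer lies strictly between `1` and `2`, so `(n - 1) (n - 2) ≥ 0`. -/
theorem sum_sq_lt_sum_sq_of_eq_one_or_two {f g : ι → ℕ} (hf : ∀ i, f i = 1 ∨ f i = 2)
    (hg₁ : ∀ i, 1 ≤ g i) (hg : ¬ ∀ i, g i = 1 ∨ g i = 2) (hsum : ∑ i, f i = ∑ i, g i) :
    ∑ i, f i ^ 2 < ∑ i, g i ^ 2 := by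
  have hfeq (i) : f i ^ 2 + 2 = 3 * f i := by obtain h | h := hf i <;> rw [h] <;> norm_num
  have hgle (i) : 3 * g i ≤ g i ^ 2 + 2 := by
    obtain h | h := (hg₁ i).eq_or_lt
    · rw [← h]; norm_num
    · nlinarith
  obtain ⟨i, hi⟩ := not_forall.1 hg
  have hglt : 3 * g i < g i ^ 2 + 2 := by
    have := hg₁ i
    have : 3 ≤ g i := by lia
    nlinarith
  have hlt : ∑ i, (f i ^ 2 + 2) < ∑ i, (g i ^ 2 + 2) := calc
    ∑ i, (f i ^ 2 + 2) = ∑ i, 3 * g i := by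
      rw [Finset.sum_congr rfl fun i _ => hfeq i, ← Finset.mul_sum, hsum, Finset.mul_sum]
    _ < ∑ i, (g i ^ 2 + 2) :=
      Finset.sum_lt_sum (fun i _ => hgle i) ⟨i, Finset.mem_univ i, hglt⟩
  simpa only [Finset.sum_add_distrib, add_lt_add_iff_right] using hlt

theorem sum_pow_eq_of_eq_one_or_two {R : Type*} [CommRing R] {f : ι → R}
    (hf : ∀ i, f i = 1 ∨ f i = 2) (t : ℕ) :
    ∑ i, f i ^ t = (2 ^ t - 1) * ∑ i, f i + (2 - 2 ^ t) * Fintype.card ι := by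
  have hterm (i) : f i ^ t = (2 ^ t - 1) * f i + (2 - 2 ^ t) := by
    obtain h | h := hf i <;> rw [h] <;> ring
  rw [Finset.sum_congr rfl fun i _ => hterm i, Finset.sum_add_distrib, ← Finset.mul_sum,
    Finset.sum_const, Finset.card_univ, nsmul_eq_mul, mul_comm (Fintype.card ι : R)]

variable [DecidableEq ι] {E F : Finset (Finset ι)} {k : ℕ} {α : ℝ}

theorem sum_familyDegree (hE : ∀ e ∈ E, e.card = k) : ∑ i, familyDegree E i = E.card * k := by
  have h := sum_sum_mem_eq_sum_familyDegree_mul E fun _ => 1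
  simp only [mul_one, Finset.sum_const, nsmul_eq_mul] at h
  rw [Finset.sum_congr rfl fun e he => by rw [hE e he], Finset.sum_const, nsmul_eq_mul] at h
  exact_mod_cast h.symm

/-- The degree pattern that characterises hypercycles: all degrees are `1` or `2`, and each
hyperedge has degree sum `k + 2`, so that exactly two of its `k` vertices have degree `2`. -/
structure HasHypercycleDegrees (E : Finset (Finset ι)) (k : ℕ) : Prop where
  familyDegree_eq : ∀ i, familyDegree E i = 1 ∨ familyDegree E i = 2
  sum_familyDegree_eq : ∀ e ∈ E, ∑ v ∈ e, familyDegree E v = k + 2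

theorem trace_familyTensor_eq_of_sum_pow_eq (hE : IsLinearUniform E k) (hF : IsLinearUniform F k)
    (hk : 3 ≤ k) (hα₀ : 0 < α) (hα₁ : α < 1)
    (h : ∀ t, ∑ i, (familyDegree F i : ℝ) ^ t = ∑ i, (familyDegree E i : ℝ) ^ t) {t : ℕ}
    (ht : t < k + 2) : (familyTensor F k α).trace t = (familyTensor E k α).trace t := by
  obtain rfl | ht₀ := eq_or_ne t 0
  · exact trace_zero_eq _ _
  obtain htk | htk := lt_or_ge t k
  · obtain ⟨c, -, hc⟩ := exists_trace_familyTensor_eq_of_lt ι hk hα₀ ht₀ htk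
    rw [hc E hE, hc F hF, h]
  · obtain ⟨r, rfl⟩ := Nat.exists_eq_add_of_le htk
    obtain ⟨a, b, hab⟩ := exists_trace_familyTensor_add_eq ι hk hα₀ hα₁ (r := r) (by lia)
    rw [hab E hE, hab F hF, h, h]

theorem trace_familyTensor_two_lt (hE : IsLinearUniform E k) (hF : IsLinearUniform F k)
    (hk : 3 ≤ k) (hα₀ : 0 < α)
    (h : ∑ i, familyDegree F i ^ 2 < ∑ i, familyDegree E i ^ 2) :
    (familyTensor F k α).trace 2 < (familyTensor E k α).trace 2 := by
  obtain ⟨c, hc, heq⟩ := exists_trace_familyTensor_eq_of_lt ι hk hα₀ two_ne_zero hk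
  rw [heq E hE, heq F hF]
  exact mul_lt_mul_of_pos_left (by exact_mod_cast h) hc

theorem trace_familyTensor_one_eq (hE : IsLinearUniform E k) (hF : IsLinearUniform F k)
    (hk : 3 ≤ k) (hα₀ : 0 < α) (hcard : F.card = E.card) :
    (familyTensor F k α).trace 1 = (familyTensor E k α).trace 1 := by
  obtain ⟨c, -, hc⟩ := exists_trace_familyTensor_eq_of_lt ι hk hα₀ one_ne_zero (by lia)
  simp only [hc E hE, hc F hF, pow_one, ← Nat.cast_sum, sum_familyDegree hE.card_eq,
    sum_familyDegree hF.card_eq, hcard]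

theorem trace_familyTensor_add_two_lt (hE : IsLinearUniform E k) (hF : IsLinearUniform F k)
    (hk : 3 ≤ k) (hα₀ : 0 < α) (hα₁ : α < 1) (hcard : F.card = E.card)
    (h : ∀ t, ∑ i, (familyDegree F i : ℝ) ^ t = ∑ i, (familyDegree E i : ℝ) ^ t) {c : ℕ}
    (hFsum : ∀ e ∈ F, ∑ v ∈ e, familyDegree F v = c)
    (hEsum : ∃ e ∈ E, ∑ v ∈ e, familyDegree E v ≠ c) :
    (familyTensor F k α).trace (k + 2) < (familyTensor E k α).trace (k + 2) := by
  obtain ⟨a, b, q, hq, heq⟩ := exists_trace_familyTensor_add_two_eq ι hk hα₀ hα₁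
  rw [heq E hE, heq F hF, h, h]
  have hsum : ∑ e ∈ F, ∑ v ∈ e, (familyDegree F v : ℝ) =
      ∑ e ∈ E, ∑ v ∈ e, (familyDegree E v : ℝ) := by
    simp only [sum_sum_mem_eq_sum_familyDegree_mul, ← pow_two, h]
  gcongr _ + q * ?_
  exact sum_sq_lt_sum_sq_of_sum_eq (c := (c : ℝ)) hcard hsum
    (fun e he => by exact_mod_cast hFsum e he) (by exact_mod_cast hEsum)

theorem HasHypercycleDegrees.exists_trace_lt (hFk : HasHypercycleDegrees F k)
    (hE : IsLinearUniform E k) (hF : IsLinearUniform F k) (hk : 3 ≤ k) (hα₀ : 0 < α)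
    (hα₁ : α < 1) (hcard : F.card = E.card) (hEdeg : ∀ i, 1 ≤ familyDegree E i)
    (hEk : ¬ HasHypercycleDegrees E k) :
    ∃ d ∈ Set.Icc 1 (k + 2),
      (∀ t < d, (familyTensor F k α).trace t = (familyTensor E k α).trace t) ∧
        (familyTensor F k α).trace d < (familyTensor E k α).trace d := by
  have hsum : ∑ i, familyDegree F i = ∑ i, familyDegree E i := by
    rw [sum_familyDegree hF.card_eq, sum_familyDegree hE.card_eq, hcard]
  by_cases hdeg : ∀ i, familyDegree E i = 1 ∨ familyDegree E i = 2
  · have hpow (t : ℕ) :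
        ∑ i, (familyDegree F i : ℝ) ^ t = ∑ i, (familyDegree E i : ℝ) ^ t := by
      rw [sum_pow_eq_of_eq_one_or_two fun i => by exact_mod_cast hFk.familyDegree_eq i,
        sum_pow_eq_of_eq_one_or_two fun i => by exact_mod_cast hdeg i]
      rw [← Nat.cast_sum, ← Nat.cast_sum, hsum]
    have hedge : ∃ e ∈ E, ∑ v ∈ e, familyDegree E v ≠ k + 2 := by
      by_contra! h
      exact hEk ⟨hdeg, h⟩
    exact ⟨k + 2, ⟨by lia, le_rfl⟩,
      fun t ht => trace_familyTensor_eq_of_sum_pow_eq hE hF hk hα₀ hα₁ hpow ht,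
      trace_familyTensor_add_two_lt hE hF hk hα₀ hα₁ hcard hpow hFk.sum_familyDegree_eq hedge⟩
  · refine ⟨2, ⟨one_le_two, by lia⟩, fun t ht => ?_, trace_familyTensor_two_lt hE hF hk hα₀
      (sum_sq_lt_sum_sq_of_eq_one_or_two hFk.familyDegree_eq hEdeg hdeg hsum)⟩
    obtain rfl | rfl := Nat.le_one_iff_eq_zero_or_eq_one.1 (Nat.le_of_lt_succ ht)
    · exact trace_zero_eq _ _
    · exact trace_familyTensor_one_eq hE hF hk hα₀ hcard

end Comparison

section Isomorphism

variable {ι κ : Type*} {E : Finset (Finset ι)} {F : Finset (Finset κ)} {k : ℕ}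

theorem mem_map_finsetCongr (ψ : ι ≃ κ) (s : Finset ι) :
    s ∈ E ↔ s.map ψ.toEmbedding ∈ E.map ψ.finsetCongr.toEmbedding :=
  (Finset.mem_map' ψ.finsetCongr.toEmbedding).symm

variable [DecidableEq ι] [DecidableEq κ]

theorem familyDegree_comp (ψ : ι ≃ κ) (h : ∀ s, s ∈ E ↔ s.map ψ.toEmbedding ∈ F) (i : ι) :
    familyDegree F (ψ i) = familyDegree E i := by
  refine (Finset.card_equiv ψ.finsetCongr fun s => ?_).symm
  simp [h s]

theorem familyTensor_comp (ψ : ι ≃ κ) (h : ∀ s, s ∈ E ↔ s.map ψ.toEmbedding ∈ F) (k : ℕ)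
    (α : ℝ) : (fun i a => familyTensor F k α (ψ i) (ψ ∘ a)) = familyTensor E k α := by
  funext i a
  have hmap : (insert i (Finset.univ.image a)).map ψ.toEmbedding =
      insert (ψ i) (Finset.univ.image (ψ ∘ a)) := by
    rw [Finset.map_insert, Finset.map_eq_image, Finset.image_image]
    rfl
  simp only [familyTensor, familyDegree_comp ψ h, h, hmap, Function.comp_apply,
    ψ.apply_eq_iff_eq]

theorem IsLinearUniform.map (hE : IsLinearUniform E k) (ψ : ι ≃ κ) :
    IsLinearUniform (E.map ψ.finsetCongr.toEmbedding) k where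
  card_eq := Finset.forall_mem_map.2 fun e he => (Finset.card_map _).trans (hE.card_eq e he)
  card_inter_le := by
    refine Finset.forall_mem_map.2 fun e he => Finset.forall_mem_map.2 fun f hf hef => ?_
    simp only [Equiv.coe_toEmbedding, Equiv.finsetCongr_apply, ← Finset.map_inter,
      Finset.card_map]
    exact hE.card_inter_le e he f hf fun h => hef (h ▸ rfl)

theorem HasHypercycleDegrees.map (hE : HasHypercycleDegrees E k) (ψ : ι ≃ κ) :
    HasHypercycleDegrees (E.map ψ.finsetCongr.toEmbedding) k where
  familyDegree_eq i := by
    rw [← ψ.apply_symm_apply i, familyDegree_comp ψ (mem_map_finsetCongr ψ)]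
    exact hE.familyDegree_eq _
  sum_familyDegree_eq := Finset.forall_mem_map.2 fun e he => by
    simp only [Equiv.coe_toEmbedding, Equiv.finsetCongr_apply, Finset.sum_map,
      familyDegree_comp ψ (mem_map_finsetCongr ψ)]
    exact hE.sum_familyDegree_eq e he

end Isomorphism

end RTensor

/-! ### Connected graphs with exactly one cycle -/

section UnicyclicGraph

open SimpleGraph

variable {V : Type*} {G : SimpleGraph V} {e : Sym2 V} {x : V} {c : G.Walk x x}

theorem card_edgeSet_deleteEdges_singleton [Finite V] (he : e ∈ G.edgeSet) :
    Nat.card (G.deleteEdges {e}).edgeSet + 1 = Nat.card G.edgeSet := by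
  rw [edgeSet_deleteEdges]
  exact Set.ncard_sdiff_singleton_add_one he (Set.toFinite _)

theorem connected_deleteEdges_of_mem_cycle (hG : G.Connected) (hc : c.IsCycle)
    (he : e ∈ c.edges) : (G.deleteEdges {e}).Connected := by
  induction e with
  | _ a b => exact hG.connected_delete_edge_of_not_isBridge fun h => h.notMem_edges_of_isCycle hc he

theorem isAcyclic_deleteEdges_singleton_iff :
    (G.deleteEdges {e}).IsAcyclic ↔ ∀ ⦃x⦄ (c : G.Walk x x), c.IsCycle → e ∈ c.edges := by
  constructor
  · intro hacyc x c hc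
    by_contra hec
    refine hacyc _ (hc.transfer fun f hf => ?_)
    rw [edgeSet_deleteEdges]
    exact ⟨c.edges_subset_edgeSet hf, fun h => hec (h ▸ hf)⟩
  · intro h x c hc
    have he := h _ (hc.mapLe (G.deleteEdges_le {e}))
    rw [Walk.edges_mapLe_eq_edges] at he
    have he' := c.edges_subset_edgeSet he
    rw [edgeSet_deleteEdges] at he'
    exact he'.2 rfl

theorem isAcyclic_deleteEdges_singleton_iff_card_eq [Finite V] (hG : G.Connected)
    (hc : c.IsCycle) (he : e ∈ c.edges) :
    (G.deleteEdges {e}).IsAcyclic ↔ Nat.card G.edgeSet = Nat.card V := by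
  have hG' := connected_deleteEdges_of_mem_cycle hG hc he
  rw [← card_edgeSet_deleteEdges_singleton (c.edges_subset_edgeSet he)]
  exact ⟨fun h => (isTree_iff_connected_and_card.1 ⟨hG', h⟩).2,
    fun h => (isTree_iff_connected_and_card.2 ⟨hG', h⟩).isAcyclic⟩

theorem cycle_toSubgraph_le {y : V} {c' : G.Walk y y} (hc : c.IsCycle)
    (h : ∀ e ∈ c.edges, e ∈ c'.edges) : c.toSubgraph ≤ c'.toSubgraph := by
  rw [Walk.toSubgraph_le_iff hc.not_nil, Walk.edgeSet_toSubgraph]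
  exact h

theorem existsUnique_cycle_iff [Finite V] (hG : G.Connected) :
    (∃! C : G.Subgraph, ∃ (x : V) (c : G.Walk x x), c.IsCycle ∧ c.toSubgraph = C) ↔
      Nat.card G.edgeSet = Nat.card V := by
  constructor
  · rintro ⟨_, ⟨x, c, hc, rfl⟩, hunique⟩
    obtain ⟨e, he⟩ := List.exists_mem_of_ne_nil c.edges fun h => hc.not_nil (Walk.edges_eq_nil.1 h)
    rw [← isAcyclic_deleteEdges_singleton_iff_card_eq hG hc he, isAcyclic_deleteEdges_singleton_iff]
    intro y c' hc'
    rw [← Walk.mem_edges_toSubgraph, hunique _ ⟨y, c', hc', rfl⟩, Walk.mem_edges_toSubgraph]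
    exact he
  · intro hcard
    have hedges : ∀ {x y : V} {c : G.Walk x x} {c' : G.Walk y y}, c.IsCycle → c'.IsCycle →
        ∀ e ∈ c.edges, e ∈ c'.edges := fun hc hc' _ he =>
      isAcyclic_deleteEdges_singleton_iff.1
        ((isAcyclic_deleteEdges_singleton_iff_card_eq hG hc he).2 hcard) _ hc'
    have hcyclic : ¬ G.IsAcyclic := by
      intro h
      have := (isTree_iff_connected_and_card.1 ⟨hG, h⟩).2
      lia
    simp only [IsAcyclic, not_forall, not_not] at hcyclic
    obtain ⟨x, c, hc⟩ := hcyclic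
    refine ⟨_, ⟨x, c, hc, rfl⟩, ?_⟩
    rintro _ ⟨y, c', hc', rfl⟩
    exact le_antisymm (cycle_toSubgraph_le hc' (hedges hc' hc))
      (cycle_toSubgraph_le hc (hedges hc hc'))

end UnicyclicGraph

/-! ### Counting in unicyclic hypergraphs -/

section IncidenceGraph

open Hypergraph

variable {β : Type*} {H : Hypergraph β} {k : ℕ}

theorem incidenceGraph_adj_inl_inr {v : H.vertexSet} {e : H.edgeSet} :
    H.incidenceGraph.Adj (Sum.inl v) (Sum.inr e) ↔ (v : β) ∈ (e : Set β) := by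
  simp [incidenceGraph]

theorem incidenceGraph_adj_inr_inl {v : H.vertexSet} {e : H.edgeSet} :
    H.incidenceGraph.Adj (Sum.inr e) (Sum.inl v) ↔ (v : β) ∈ (e : Set β) := by
  rw [SimpleGraph.adj_comm, incidenceGraph_adj_inl_inr]

theorem not_incidenceGraph_adj_inl_inl {v w : H.vertexSet} :
    ¬ H.incidenceGraph.Adj (Sum.inl v) (Sum.inl w) := by
  simp [incidenceGraph]

theorem not_incidenceGraph_adj_inr_inr {e f : H.edgeSet} :
    ¬ H.incidenceGraph.Adj (Sum.inr e) (Sum.inr f) := by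
  simp [incidenceGraph]

theorem connected_incidenceGraph (h : H.IsConnected) (hne : ∀ e ∈ H.edgeSet, e.Nonempty) :
    H.incidenceGraph.Connected := by
  obtain ⟨v, hv⟩ := h.1
  refine (SimpleGraph.connected_iff_exists_forall_reachable _).2 ⟨Sum.inl ⟨v, hv⟩, ?_⟩
  rintro (w | ⟨e, he⟩)
  · exact h.2 _ _
  · obtain ⟨w, hw⟩ := hne e he
    exact (h.2 ⟨v, hv⟩ ⟨w, subset_vertexSet_of_mem_edgeSet he hw⟩).trans
      (SimpleGraph.Adj.reachable (incidenceGraph_adj_inl_inr.2 hw))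

/-- The edges of the incidence graph, viewed as the incident pairs of a hyperedge and a vertex. -/
noncomputable def incidenceEquiv (H : Hypergraph β) :
    (Σ e : H.edgeSet, {v : H.vertexSet // (v : β) ∈ (e : Set β)}) ≃ H.incidenceGraph.edgeSet :=
  Equiv.ofBijective
    (fun p => ⟨s(Sum.inl p.2.1, Sum.inr p.1), incidenceGraph_adj_inl_inr.2 p.2.2⟩) (by
      constructor
      · rintro ⟨e, v, hv⟩ ⟨f, w, hw⟩ h
        have h' := Sym2.eq_iff.1 (Subtype.ext_iff.1 h)
        simp only [Sum.inl.injEq, Sum.inr.injEq, reduceCtorEq, and_self, or_false] at h'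
        obtain ⟨rfl, rfl⟩ := h'
        rfl
      · rintro ⟨x, hx⟩
        induction x with
        | _ a b =>
          rcases a with v | e <;> rcases b with w | f
          · exact absurd hx not_incidenceGraph_adj_inl_inl
          · exact ⟨⟨f, v, incidenceGraph_adj_inl_inr.1 hx⟩, rfl⟩
          · exact ⟨⟨e, w, incidenceGraph_adj_inr_inl.1 hx⟩, Subtype.ext Sym2.eq_swap⟩
          · exact absurd hx not_incidenceGraph_adj_inr_inr)

theorem finite_edgeSet [Finite H.vertexSet] : Finite H.edgeSet :=
  (Set.Finite.finite_subsets (Set.toFinite H.vertexSet)).subset fun _ he =>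
    subset_vertexSet_of_mem_edgeSet he

theorem card_edgeSet_incidenceGraph [Finite H.vertexSet] (h : H.IsUniform k) :
    Nat.card H.incidenceGraph.edgeSet = H.edgeSet.ncard * k := by
  have := finite_edgeSet (H := H)
  have := Fintype.ofFinite H.edgeSet
  have hcard : ∀ e : H.edgeSet, Nat.card {v : H.vertexSet // (v : β) ∈ (e : Set β)} = k := by
    intro e
    rw [← h e e.2, ← Nat.card_coe_set_eq]
    exact Nat.card_congr (Equiv.subtypeSubtypeEquivSubtype
      fun {_} hv => subset_vertexSet_of_mem_edgeSet e.2 hv)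
  rw [← Nat.card_congr (incidenceEquiv H), Nat.card_sigma, Finset.sum_congr rfl fun e _ => hcard e,
    Finset.sum_const, smul_eq_mul, Finset.card_univ, ← Nat.card_eq_fintype_card,
    Nat.card_coe_set_eq]

theorem edge_nonempty_of_isUniform (hk : 1 ≤ k) (h : H.IsUniform k) :
    ∀ e ∈ H.edgeSet, e.Nonempty := fun e he =>
  Set.nonempty_of_ncard_ne_zero (by rw [h e he]; lia)

theorem isUnicyclic_iff [Finite H.vertexSet] (hk : 1 ≤ k) (hu : H.IsUniform k)
    (h : H.IsConnected) :
    H.IsUnicyclic ↔ H.edgeSet.ncard * k = Nat.card H.vertexSet + H.edgeSet.ncard := by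
  have := finite_edgeSet (H := H)
  rw [IsUnicyclic, and_iff_right h,
    existsUnique_cycle_iff (connected_incidenceGraph h (edge_nonempty_of_isUniform hk hu)),
    card_edgeSet_incidenceGraph hu, Nat.card_sum, Nat.card_coe_set_eq H.edgeSet]

theorem one_le_degree [Finite H.vertexSet] (h : H.IsConnected) (hne : H.edgeSet.Nonempty)
    (hne' : ∀ e ∈ H.edgeSet, e.Nonempty) (v : H.vertexSet) : 1 ≤ H.degree v := by
  obtain ⟨e, he⟩ := hne
  have : Nontrivial (H.vertexSet ⊕ H.edgeSet) :=
    ⟨Sum.inl v, Sum.inr ⟨e, he⟩, Sum.inl_ne_inr⟩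
  obtain ⟨w | f, hadj⟩ :=
    (connected_incidenceGraph h hne').preconnected.exists_adj_of_nontrivial (Sum.inl v)
  · exact absurd hadj not_incidenceGraph_adj_inl_inl
  · have := finite_edgeSet (H := H)
    exact (Set.ncard_pos ((Set.toFinite H.edgeSet).subset fun _ h => h.1)).2
      ⟨f, f.2, incidenceGraph_adj_inl_inr.1 hadj⟩

end IncidenceGraph

/-! ### The hyperedges as finite sets of vertices -/

section EdgeFamily

open Hypergraph RTensor

variable {β β₁ β₂ : Type*} {H : Hypergraph β} {k : ℕ}

theorem image_val_injective :
    Function.Injective fun s : Finset H.vertexSet => Subtype.val '' (s : Set H.vertexSet) :=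
  (Set.image_injective.2 Subtype.val_injective).comp Finset.coe_injective

theorem ncard_image_val (s : Finset H.vertexSet) :
    (Subtype.val '' (s : Set H.vertexSet)).ncard = s.card := by
  rw [Set.ncard_image_of_injective _ Subtype.val_injective, Set.ncard_coe_finset]

open Classical in
/-- The hyperedges as finsets of vertices. -/
noncomputable def edgeFamily (H : Hypergraph β) [Fintype H.vertexSet] :
    Finset (Finset H.vertexSet) :=
  Finset.univ.filter fun s => Subtype.val '' (s : Set H.vertexSet) ∈ H.edgeSet

variable [Fintype H.vertexSet]

theorem mem_edgeFamily {s : Finset H.vertexSet} :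
    s ∈ edgeFamily H ↔ Subtype.val '' (s : Set H.vertexSet) ∈ H.edgeSet := by
  simp [edgeFamily]

theorem exists_mem_edgeFamily {e : Set β} (he : e ∈ H.edgeSet) :
    ∃ s ∈ edgeFamily H, Subtype.val '' (s : Set H.vertexSet) = e := by
  classical
  have himage : Subtype.val '' (((Subtype.val ⁻¹' e : Set H.vertexSet).toFinset :
      Finset H.vertexSet) : Set H.vertexSet) = e := by
    rw [Set.coe_toFinset, Subtype.image_preimage_coe,
      Set.inter_eq_right.2 (subset_vertexSet_of_mem_edgeSet he)]
  exact ⟨_, mem_edgeFamily.2 (himage.symm ▸ he), himage⟩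

theorem image_edgeFamily :
    (fun s : Finset H.vertexSet => Subtype.val '' (s : Set H.vertexSet)) '' edgeFamily H =
      H.edgeSet := by
  ext e
  constructor
  · rintro ⟨s, hs, rfl⟩
    exact mem_edgeFamily.1 hs
  · exact exists_mem_edgeFamily

theorem card_edgeFamily : (edgeFamily H).card = H.edgeSet.ncard := by
  rw [← image_edgeFamily, Set.ncard_image_of_injective _ image_val_injective,
    Set.ncard_coe_finset]

variable [DecidableEq H.vertexSet]

theorem isLinearUniform_edgeFamily (huniform : H.IsUniform k) (hlinear : H.IsLinear) :
    IsLinearUniform (edgeFamily H) k where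
  card_eq s hs := by
    rw [← ncard_image_val]
    exact huniform _ (mem_edgeFamily.1 hs)
  card_inter_le s hs t ht hst := by
    rw [Finset.card_le_one]
    intro a ha b hb
    rw [Finset.mem_inter] at ha hb
    exact Subtype.ext (hlinear _ (mem_edgeFamily.1 hs) _ (mem_edgeFamily.1 ht)
      (fun h => hst (image_val_injective h))
      ⟨⟨a, ha.1, rfl⟩, ⟨a, ha.2, rfl⟩⟩ ⟨⟨b, hb.1, rfl⟩, ⟨b, hb.2, rfl⟩⟩)

theorem familyDegree_edgeFamily (v : H.vertexSet) :
    familyDegree (edgeFamily H) v = H.degree v := by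
  rw [familyDegree, degree, ← Set.ncard_coe_finset,
    ← Set.ncard_image_of_injective _ image_val_injective]
  congr 1
  ext e
  constructor
  · rintro ⟨s, hs, rfl⟩
    rw [Finset.mem_coe, Finset.mem_filter] at hs
    exact ⟨mem_edgeFamily.1 hs.1, v, hs.2, rfl⟩
  · rintro ⟨he, hv⟩
    obtain ⟨s, hs, rfl⟩ := exists_mem_edgeFamily he
    refine ⟨s, ?_, rfl⟩
    rw [Finset.mem_coe, Finset.mem_filter]
    exact ⟨hs, (Subtype.val_injective.mem_set_image).1 hv⟩

theorem alphaTensor_eq_familyTensor (k : ℕ) (α : ℝ) :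
    H.alphaTensor k α = familyTensor (edgeFamily H) k α := by
  funext i a
  simp only [alphaTensor, degreeTensor, adjacencyTensor, familyTensor, Pi.add_apply, Pi.smul_apply,
    smul_eq_mul, familyDegree_edgeFamily]
  congr 3
  rw [mem_edgeFamily, Finset.coe_insert, Finset.coe_image, Finset.coe_univ, Set.image_insert_eq,
    Set.image_univ, ← Set.range_comp]
  rfl

theorem alphaMoment_eq_trace (k : ℕ) (α : ℝ) (d : ℕ) :
    H.alphaMoment k α d = (familyTensor (edgeFamily H) k α).trace d := by
  rw [alphaMoment, ← alphaTensor_eq_familyTensor]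
  congr!

omit [DecidableEq H.vertexSet] [Fintype H.vertexSet] in
theorem alphaEq_of_isIsomorphic {H₁ : Hypergraph β₁} {H₂ : Hypergraph β₂}
    [Fintype H₁.vertexSet] [Fintype H₂.vertexSet] (h : H₁.IsIsomorphic H₂) (k : ℕ) (α : ℝ) :
    AlphaEq k α H₁ H₂ := by
  classical
  obtain ⟨ψ, hψ⟩ := h
  refine ⟨Fintype.card_congr ψ, fun t _ => ?_⟩
  rw [alphaMoment_eq_trace, alphaMoment_eq_trace, ← trace_reindex ψ,
    familyTensor_comp ψ (E := edgeFamily H₁)]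
  intro s
  rw [mem_edgeFamily, mem_edgeFamily, hψ, Finset.coe_map]
  rfl

end EdgeFamily

/-! ### The hypercycle -/

section Hypercycle

open Hypergraph RTensor

variable {k m : ℕ}

theorem finRotate_ne (hm : 2 ≤ m) (i : Fin m) : finRotate m i ≠ i :=
  Equiv.Perm.mem_support.1 (by rw [support_finRotate_of_le hm]; exact Finset.mem_univ i)

theorem finRotate_finRotate_ne (hm : 3 ≤ m) (i : Fin m) : finRotate m (finRotate m i) ≠ i := by
  obtain ⟨n, rfl⟩ : ∃ n, m = n + 3 := ⟨m - 3, by lia⟩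
  rw [finRotate_apply, finRotate_apply, add_assoc, Ne, add_eq_left]
  simp [Fin.ext_iff, Fin.val_add, Nat.mod_eq_of_lt (show 2 < n + 3 by lia)]

/-- The `i`-th hyperedge of the hypercycle as a finset, written as the disjoint sum of
`{u_i, u_{i+1}}` and `{w_{i,j} | j}`. -/
def cycleEdge (k m : ℕ) (i : Fin m) : Finset (Fin m ⊕ Fin m × Fin (k - 2)) :=
  ({i, finRotate m i} : Finset (Fin m)).disjSum ({i} ×ˢ Finset.univ)

theorem inl_mem_cycleEdge {i a : Fin m} :
    Sum.inl a ∈ cycleEdge k m i ↔ a = i ∨ a = finRotate m i := by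
  simp [cycleEdge]

theorem inr_mem_cycleEdge {i a : Fin m} {j : Fin (k - 2)} :
    Sum.inr (a, j) ∈ cycleEdge k m i ↔ a = i := by
  simp [cycleEdge, eq_comm]

theorem coe_cycleEdge (i : Fin m) : (cycleEdge k m i : Set (Fin m ⊕ Fin m × Fin (k - 2))) =
    {x | x = Sum.inl i ∨ x = Sum.inl (finRotate m i) ∨ ∃ j, x = Sum.inr (i, j)} := by
  ext x
  rcases x with a | ⟨a, j⟩
  · simp [inl_mem_cycleEdge]
  · simp [inr_mem_cycleEdge]

theorem edgeSet_hypercycle : (hypercycle k m).edgeSet =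
    Set.range fun i : Fin m => (cycleEdge k m i : Set (Fin m ⊕ Fin m × Fin (k - 2))) := by
  simp only [coe_cycleEdge]
  rfl

theorem card_cycleEdge (hk : 2 ≤ k) (hm : 2 ≤ m) (i : Fin m) : (cycleEdge k m i).card = k := by
  rw [cycleEdge, Finset.card_disjSum, Finset.card_pair (finRotate_ne hm i).symm,
    Finset.card_product, Finset.card_singleton, Finset.card_univ, Fintype.card_fin]
  lia

theorem cycleEdge_injective (hk : 3 ≤ k) : Function.Injective (cycleEdge k m) := by
  intro i j h
  have : Sum.inr (i, ⟨0, by lia⟩) ∈ cycleEdge k m i := inr_mem_cycleEdge.2 rfl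
  rw [h] at this
  exact inr_mem_cycleEdge.1 this

theorem eq_inl_of_mem_cycleEdge_of_mem_cycleEdge {i j : Fin m} (hij : i ≠ j)
    {x : Fin m ⊕ Fin m × Fin (k - 2)} (hi : x ∈ cycleEdge k m i) (hj : x ∈ cycleEdge k m j) :
    (x = Sum.inl i ∧ i = finRotate m j) ∨ (x = Sum.inl j ∧ j = finRotate m i) := by
  rcases x with a | ⟨a, p⟩
  · rw [inl_mem_cycleEdge] at hi hj
    have := (finRotate m).injective.eq_iff (a := i) (b := j)
    grind
  · exact absurd ((inr_mem_cycleEdge.1 hi).symm.trans (inr_mem_cycleEdge.1 hj)) hij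

theorem isUniform_hypercycle (hk : 2 ≤ k) (hm : 2 ≤ m) : (hypercycle k m).IsUniform k := by
  intro e he
  rw [edgeSet_hypercycle] at he
  obtain ⟨i, rfl⟩ := he
  rw [Set.ncard_coe_finset, card_cycleEdge hk hm]

theorem isLinear_hypercycle (hm : 3 ≤ m) : (hypercycle k m).IsLinear := by
  intro e he f hf hef
  rw [edgeSet_hypercycle] at he hf
  obtain ⟨i, rfl⟩ := he
  obtain ⟨j, rfl⟩ := hf
  have hij : i ≠ j := fun h => hef (by rw [h])
  have hnot : ¬ (i = finRotate m j ∧ j = finRotate m i) := fun h =>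
    finRotate_finRotate_ne hm i (by rw [← h.2, ← h.1])
  intro x hx y hy
  rcases eq_inl_of_mem_cycleEdge_of_mem_cycleEdge hij hx.1 hx.2 with ⟨rfl, hi⟩ | ⟨rfl, hj⟩ <;>
    rcases eq_inl_of_mem_cycleEdge_of_mem_cycleEdge hij hy.1 hy.2 with ⟨rfl, hi'⟩ | ⟨rfl, hj'⟩
  · rfl
  · exact absurd ⟨hi, hj'⟩ hnot
  · exact absurd ⟨hi', hj⟩ hnot
  · rfl

theorem ncard_edgeSet_hypercycle (hk : 3 ≤ k) : (hypercycle k m).edgeSet.ncard = m := by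
  rw [edgeSet_hypercycle, ← Set.image_univ, Set.ncard_image_of_injective _
    (fun _ _ h => cycleEdge_injective hk (Finset.coe_injective h)), Set.ncard_univ, Nat.card_fin]

theorem card_vertexSet_hypercycle :
    Fintype.card (hypercycle k m).vertexSet = m + m * (k - 2) := by
  refine (Fintype.card_congr (Equiv.Set.univ _)).trans ?_
  simp only [Fintype.card_sum, Fintype.card_prod, Fintype.card_fin]

theorem reachable_of_mem_cycleEdge {i : Fin m} {x y : (hypercycle k m).vertexSet}
    (hx : x.1 ∈ cycleEdge k m i) (hy : y.1 ∈ cycleEdge k m i) :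
    (hypercycle k m).incidenceGraph.Reachable (Sum.inl x) (Sum.inl y) := by
  have he : (cycleEdge k m i : Set _) ∈ (hypercycle k m).edgeSet := by
    rw [edgeSet_hypercycle]
    exact ⟨i, rfl⟩
  exact (SimpleGraph.Adj.reachable (incidenceGraph_adj_inl_inr (e := ⟨_, he⟩).2 hx)).trans
    (SimpleGraph.Adj.reachable (incidenceGraph_adj_inr_inl.2 hy))

theorem isConnected_hypercycle (hm : 1 ≤ m) : (hypercycle k m).IsConnected := by
  obtain ⟨n, rfl⟩ : ∃ n, m = n + 1 := ⟨m - 1, by lia⟩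
  have hinl (i : Fin (n + 1)) : (hypercycle k (n + 1)).incidenceGraph.Reachable
      (Sum.inl ⟨Sum.inl 0, trivial⟩) (Sum.inl ⟨Sum.inl i, trivial⟩) := by
    induction i using Fin.induction with
    | zero => rfl
    | succ i ih =>
      refine ih.trans (reachable_of_mem_cycleEdge (i := i.castSucc)
        (inl_mem_cycleEdge.2 (Or.inl rfl)) (inl_mem_cycleEdge.2 (Or.inr ?_)))
      rw [finRotate_apply, Fin.coeSucc_eq_succ]
  have hzero (x : (hypercycle k (n + 1)).vertexSet) :
      (hypercycle k (n + 1)).incidenceGraph.Reachable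
        (Sum.inl ⟨Sum.inl 0, trivial⟩) (Sum.inl x) := by
    obtain ⟨i | ⟨i, j⟩, -⟩ := x
    · exact hinl i
    · exact (hinl i).trans (reachable_of_mem_cycleEdge (inl_mem_cycleEdge.2 (Or.inl rfl))
        (inr_mem_cycleEdge.2 rfl))
  exact ⟨⟨Sum.inl 0, trivial⟩, fun x y => (hzero x).symm.trans (hzero y)⟩

theorem isLinearUnicyclic_hypercycle (hk : 3 ≤ k) (hm : 3 ≤ m) :
    (hypercycle k m).IsLinearUnicyclic k m where
  uniform := isUniform_hypercycle (by lia) (by lia)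
  linear := isLinear_hypercycle hm
  unicyclic := by
    rw [isUnicyclic_iff (by lia : 1 ≤ k) (isUniform_hypercycle (by lia) (by lia))
      (isConnected_hypercycle (by lia)), Nat.card_eq_fintype_card, card_vertexSet_hypercycle,
      ncard_edgeSet_hypercycle hk]
    obtain ⟨l, rfl⟩ : ∃ l, k = l + 2 := ⟨k - 2, by lia⟩
    rw [Nat.add_sub_cancel]
    ring
  ncard_edgeSet := ncard_edgeSet_hypercycle hk

theorem degree_hypercycle (hk : 3 ≤ k) (x : Fin m ⊕ Fin m × Fin (k - 2)) :
    (hypercycle k m).degree x = (Finset.univ.filter fun i => x ∈ cycleEdge k m i).card := by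
  rw [degree, edgeSet_hypercycle, ← Set.ncard_coe_finset, ← Set.ncard_image_of_injective _
    (Finset.coe_injective.comp (cycleEdge_injective (m := m) hk))]
  congr 1
  ext e
  constructor
  · rintro ⟨⟨i, rfl⟩, hx⟩
    exact ⟨i, by simpa using hx, rfl⟩
  · rintro ⟨i, hx, rfl⟩
    exact ⟨⟨i, rfl⟩, by simpa using hx⟩

theorem degree_hypercycle_inl (hk : 3 ≤ k) (hm : 2 ≤ m) (a : Fin m) :
    (hypercycle k m).degree (Sum.inl a) = 2 := by
  have hfilter : (Finset.univ.filter fun i => Sum.inl a ∈ cycleEdge k m i) =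
      {a, (finRotate m).symm a} := by
    ext i
    simp only [inl_mem_cycleEdge, Finset.mem_filter, Finset.mem_univ, true_and, Finset.mem_insert,
      Finset.mem_singleton, Equiv.eq_symm_apply, eq_comm]
  rw [degree_hypercycle hk, hfilter, Finset.card_pair]
  rw [Ne, Equiv.eq_symm_apply]
  exact finRotate_ne hm a

theorem degree_hypercycle_inr (hk : 3 ≤ k) (a : Fin m) (j : Fin (k - 2)) :
    (hypercycle k m).degree (Sum.inr (a, j)) = 1 := by
  have hfilter : (Finset.univ.filter fun i => Sum.inr (a, j) ∈ cycleEdge k m i) = {a} := by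
    ext i
    simp [inr_mem_cycleEdge, eq_comm]
  rw [degree_hypercycle hk, hfilter, Finset.card_singleton]

theorem hasHypercycleDegrees_hypercycle [DecidableEq (hypercycle k m).vertexSet] (hk : 3 ≤ k)
    (hm : 2 ≤ m) : HasHypercycleDegrees (edgeFamily (hypercycle k m)) k where
  familyDegree_eq v := by
    rw [familyDegree_edgeFamily]
    rcases v with ⟨a | ⟨a, j⟩, _⟩
    · exact Or.inr (degree_hypercycle_inl hk hm a)
    · exact Or.inl (degree_hypercycle_inr hk a j)
  sum_familyDegree_eq s hs := by
    rw [mem_edgeFamily, edgeSet_hypercycle] at hs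
    obtain ⟨i, hi⟩ := hs
    have hmap : s.map (Function.Embedding.subtype _) = cycleEdge k m i := by
      rw [← Finset.coe_inj, Finset.coe_map]
      exact hi.symm
    calc ∑ v ∈ s, familyDegree (edgeFamily (hypercycle k m)) v
        = ∑ v ∈ s, (hypercycle k m).degree v :=
          Finset.sum_congr rfl fun v _ => familyDegree_edgeFamily v
      _ = ∑ x ∈ cycleEdge k m i, (hypercycle k m).degree x := by
          rw [← hmap, Finset.sum_map]
          rfl
      _ = 2 + 2 + (k - 2) := by
          rw [cycleEdge, Finset.sum_disjSum, Finset.sum_pair (finRotate_ne hm i).symm,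
            degree_hypercycle_inl hk hm, degree_hypercycle_inl hk hm,
            Finset.sum_congr rfl fun x _ => degree_hypercycle_inr hk x.1 x.2]
          simp
      _ = k + 2 := by lia

end Hypercycle

/-! ### Recognition of the hypercycle -/

namespace RTensor

theorem HasHypercycleDegrees.card_filter_familyDegree_eq_two {ι : Type*} [DecidableEq ι]
    {E : Finset (Finset ι)} {k : ℕ} (hE : HasHypercycleDegrees E k) {e : Finset ι} (he : e ∈ E)
    (hek : e.card = k) : (e.filter fun v => familyDegree E v = 2).card = 2 := by
  have hdegree (v : ι) : familyDegree E v = 1 + if familyDegree E v = 2 then 1 else 0 := by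
    obtain h | h := hE.familyDegree_eq v <;> simp [h]
  have hsum := hE.sum_familyDegree_eq e he
  rw [Finset.sum_congr rfl fun v _ => hdegree v, Finset.sum_add_distrib, Finset.sum_boole,
    Finset.sum_const, hek] at hsum
  simpa using hsum

end RTensor

section CyclicSequence

open Hypergraph RTensor

variable {β : Type*} {H : Hypergraph β} {k l : ℕ}

/-- The cycle `u_0 f_0 u_1 f_1 ⋯ u_{l-1} f_{l-1} u_0` of a hypergraph; indices are taken
modulo `l`. -/
structure IsCyclicSequence (u : Fin l → H.vertexSet) (f : Fin l → H.edgeSet) : Prop where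
  vertex_injective : Function.Injective u
  edge_injective : Function.Injective f
  mem : ∀ i, (u i : β) ∈ (f i : Set β)
  finRotate_mem : ∀ i, (u (finRotate l i) : β) ∈ (f i : Set β)

theorem even_iff_isLeft_getVert {u : H.vertexSet} {y : H.vertexSet ⊕ H.edgeSet}
    (c : H.incidenceGraph.Walk (Sum.inl u) y) {i : ℕ} (hi : i ≤ c.length) :
    Even i ↔ (c.getVert i).isLeft := by
  let color : H.incidenceGraph.Coloring Bool := SimpleGraph.Coloring.mk Sum.isLeft fun {x y} h => by
    rcases x with v | e <;> rcases y with w | f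
    · exact absurd h not_incidenceGraph_adj_inl_inl
    · simp
    · simp
    · exact absurd h not_incidenceGraph_adj_inr_inr
  have h := color.even_length_iff_congr (c.take i)
  rw [SimpleGraph.Walk.take_length, min_eq_left hi] at h
  rw [h]
  exact ⟨fun h => h.1 rfl, fun h => ⟨fun _ => h, fun _ => rfl⟩⟩

theorem exists_isCycle_inl {x : H.vertexSet ⊕ H.edgeSet} {c : H.incidenceGraph.Walk x x}
    (hc : c.IsCycle) :
    ∃ (u : H.vertexSet) (c : H.incidenceGraph.Walk (Sum.inl u) (Sum.inl u)), c.IsCycle := by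
  classical
  rcases x with u | e
  · exact ⟨u, c, hc⟩
  have hadj := c.adj_snd hc.not_nil
  have hmem : c.snd ∈ c.support := c.getVert_mem_support 1
  rcases hsnd : c.snd with v | f
  · rw [hsnd] at hmem
    exact ⟨v, c.rotate _ hmem, hc.rotate hmem⟩
  · rw [hsnd] at hadj
    exact absurd hadj not_incidenceGraph_adj_inr_inr

theorem exists_isCyclicSequence {x : H.vertexSet ⊕ H.edgeSet} {c : H.incidenceGraph.Walk x x}
    (hc : c.IsCycle) : ∃ (l : ℕ) (u : Fin l → H.vertexSet) (f : Fin l → H.edgeSet),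
      2 ≤ l ∧ IsCyclicSequence u f := by
  obtain ⟨u₀, c, hc⟩ := exists_isCycle_inl hc
  have hlength := hc.three_le_length
  obtain ⟨n, hn⟩ : ∃ n, c.length = 2 * (n + 1) := by
    obtain ⟨l, hl⟩ := (even_iff_isLeft_getVert c le_rfl).2 (by simp)
    exact ⟨l - 1, by lia⟩
  choose u hu using fun i : Fin (n + 1) => Sum.isLeft_iff.1
    ((even_iff_isLeft_getVert c (i := 2 * i) (by lia)).1 (even_two_mul _))
  choose f hf using fun i : Fin (n + 1) => Sum.isRight_iff.1 (Sum.not_isLeft.1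
    (((even_iff_isLeft_getVert c (i := 2 * i + 1) (by lia)).not).1
      (Nat.not_even_iff_odd.2 (odd_two_mul_add_one _))))
  refine ⟨n + 1, u, f, by lia, fun i j hij => ?_, fun i j hij => ?_, fun i => ?_, fun i => ?_⟩
  · have := hc.getVert_injOn' (x₁ := 2 * i) (x₂ := 2 * j) (by simp only [Set.mem_ofPred_eq]; lia)
      (by simp only [Set.mem_ofPred_eq]; lia) (by rw [hu, hu, hij])
    lia
  · have := hc.getVert_injOn' (x₁ := 2 * i + 1) (x₂ := 2 * j + 1)
      (by simp only [Set.mem_ofPred_eq]; lia) (by simp only [Set.mem_ofPred_eq]; lia)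
      (by rw [hf, hf, hij])
    lia
  · have hadj := c.adj_getVert_succ (i := 2 * i) (by lia)
    rw [hu, hf] at hadj
    exact incidenceGraph_adj_inl_inr.1 hadj
  · have hadj := c.adj_getVert_succ (i := 2 * i + 1) (by lia)
    have hrotate :
        c.getVert (2 * i + 1 + 1) = c.getVert (2 * (finRotate (n + 1) i : Fin (n + 1))) := by
      rw [coe_finRotate]
      split_ifs with h
      · rw [h, Fin.val_last, show 2 * n + 1 + 1 = c.length by lia]
        simp
      · rfl
    rw [hrotate, hu, hf] at hadj
    exact incidenceGraph_adj_inr_inl.1 hadj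

theorem mem_of_isConnected (hH : H.IsConnected) (hne : ∀ e ∈ H.edgeSet, e.Nonempty)
    {S : Set H.edgeSet} (hS : S.Nonempty)
    (hclosed : ∀ e ∈ S, ∀ (e' : H.edgeSet) (v : H.vertexSet),
      (v : β) ∈ (e : Set β) → (v : β) ∈ (e' : Set β) → e' ∈ S) (e : H.edgeSet) : e ∈ S := by
  let P : H.vertexSet ⊕ H.edgeSet → Prop :=
    Sum.elim (fun v => ∃ e ∈ S, (v : β) ∈ (e : Set β)) (· ∈ S)
  have hP {a b : H.vertexSet ⊕ H.edgeSet} (p : H.incidenceGraph.Walk a b) : P a → P b := by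
    induction p with
    | nil => exact id
    | @cons a b _ hadj _ ih =>
      intro ha
      refine ih ?_
      rcases a with v | e <;> rcases b with w | e'
      · exact absurd hadj not_incidenceGraph_adj_inl_inl
      · obtain ⟨e, heS, hve⟩ := ha
        exact hclosed e heS e' v hve (incidenceGraph_adj_inl_inr.1 hadj)
      · exact ⟨e, ha, incidenceGraph_adj_inr_inl.1 hadj⟩
      · exact absurd hadj not_incidenceGraph_adj_inr_inr
  obtain ⟨e₀, he₀⟩ := hS
  obtain ⟨p⟩ := (connected_incidenceGraph hH hne).preconnected (Sum.inr e₀) (Sum.inr e)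
  exact hP p he₀

section Degrees

variable [Finite H.vertexSet] {v : β} {e f g : Set β}

theorem finite_edges_containing (v : β) : {e ∈ H.edgeSet | v ∈ e}.Finite :=
  have := finite_edgeSet (H := H)
  (Set.toFinite H.edgeSet).subset fun _ h => h.1

theorem two_le_degree (he : e ∈ H.edgeSet) (hf : f ∈ H.edgeSet) (hve : v ∈ e) (hvf : v ∈ f)
    (hef : e ≠ f) : 2 ≤ H.degree v :=
  (Set.one_lt_ncard (finite_edges_containing v)).2 ⟨e, ⟨he, hve⟩, f, ⟨hf, hvf⟩, hef⟩

theorem eq_or_eq_of_degree_le_two (hv : H.degree v ≤ 2) (he : e ∈ H.edgeSet) (hf : f ∈ H.edgeSet)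
    (hg : g ∈ H.edgeSet) (hve : v ∈ e) (hvf : v ∈ f) (hvg : v ∈ g) (hef : e ≠ f) :
    g = e ∨ g = f := by
  by_contra! hne
  exact hv.not_gt ((Set.two_lt_ncard_iff (finite_edges_containing v)).2
    ⟨e, f, g, ⟨he, hve⟩, ⟨hf, hvf⟩, ⟨hg, hvg⟩, hef, hne.1.symm, hne.2.symm⟩)

end Degrees

namespace IsCyclicSequence

variable {u : Fin l → H.vertexSet} {f : Fin l → H.edgeSet}

theorem edge_ne_edge_finRotate (h : IsCyclicSequence u f) (hl : 2 ≤ l) (i : Fin l) :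
    (f i : Set β) ≠ f (finRotate l i) := fun hf =>
  finRotate_ne hl i (h.edge_injective (Subtype.ext hf)).symm

theorem two_le_degree_vertex [Finite H.vertexSet] (h : IsCyclicSequence u f) (hl : 2 ≤ l)
    (i : Fin l) : 2 ≤ H.degree (u i) := by
  obtain ⟨j, rfl⟩ := (finRotate l).surjective i
  exact two_le_degree (f j).2 (f (finRotate l j)).2 (h.finRotate_mem j) (h.mem _)
    (h.edge_ne_edge_finRotate hl j)

section Recognition

variable [Fintype H.vertexSet] [DecidableEq H.vertexSet]

theorem eq_or_eq_of_mem_of_mem (h : IsCyclicSequence u f) (hl : 2 ≤ l) (hu : H.IsUniform k)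
    (hH : HasHypercycleDegrees (edgeFamily H) k) {i : Fin l} {e : H.edgeSet} (hne : f i ≠ e)
    {v : H.vertexSet} (hvi : (v : β) ∈ (f i : Set β)) (hve : (v : β) ∈ (e : Set β)) :
    v = u i ∨ v = u (finRotate l i) := by
  obtain ⟨s, hs, hsf⟩ := exists_mem_edgeFamily (f i).2
  have hmem {w : H.vertexSet} (hw : (w : β) ∈ (f i : Set β)) (hw₂ : 2 ≤ H.degree w) :
      w ∈ s.filter fun w => familyDegree (edgeFamily H) w = 2 := by
    rw [← hsf, Subtype.val_injective.mem_set_image] at hw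
    rw [← familyDegree_edgeFamily] at hw₂
    exact Finset.mem_filter.2 ⟨hw, by have := hH.familyDegree_eq w; lia⟩
  have hsubset : {u i, u (finRotate l i)} ⊆
      s.filter fun w => familyDegree (edgeFamily H) w = 2 :=
    Finset.insert_subset (hmem (h.mem i) (h.two_le_degree_vertex hl _))
      (Finset.singleton_subset_iff.2 (hmem (h.finRotate_mem i) (h.two_le_degree_vertex hl _)))
  have hscard : s.card = k := by rw [← ncard_image_val, hsf, hu _ (f i).2]
  have heq := Finset.eq_of_subset_of_card_le hsubset (by
    rw [hH.card_filter_familyDegree_eq_two hs hscard,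
      Finset.card_pair fun hui => finRotate_ne hl i (h.vertex_injective hui).symm])
  have hv := hmem hvi (two_le_degree (f i).2 e.2 hvi hve fun hf => hne (Subtype.ext hf))
  rw [← heq, Finset.mem_insert, Finset.mem_singleton] at hv
  exact hv

theorem mem_range_of_mem (h : IsCyclicSequence u f) (hl : 2 ≤ l) (hu : H.IsUniform k)
    (hH : HasHypercycleDegrees (edgeFamily H) k) {i : Fin l} {e : H.edgeSet} {v : H.vertexSet}
    (hvi : (v : β) ∈ (f i : Set β)) (hve : (v : β) ∈ (e : Set β)) : e ∈ Set.range f := by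
  by_cases hie : f i = e
  · exact ⟨i, hie⟩
  obtain ⟨j, rfl⟩ : ∃ j, v = u (finRotate l j) := by
    obtain h' | h' := h.eq_or_eq_of_mem_of_mem hl hu hH hie hvi hve
    · exact ⟨(finRotate l).symm i, by rwa [Equiv.apply_symm_apply]⟩
    · exact ⟨i, h'⟩
  have hdegree : H.degree (u (finRotate l j)) ≤ 2 := by
    have := hH.familyDegree_eq (u (finRotate l j))
    rw [familyDegree_edgeFamily] at this
    lia
  obtain h' | h' := eq_or_eq_of_degree_le_two hdegree (f j).2 (f (finRotate l j)).2 e.2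
    (h.finRotate_mem j) (h.mem _) hve (h.edge_ne_edge_finRotate hl j)
  · exact ⟨j, Subtype.ext h'.symm⟩
  · exact ⟨finRotate l j, Subtype.ext h'.symm⟩

theorem edge_surjective (h : IsCyclicSequence u f) (hl : 2 ≤ l) (hk : 1 ≤ k)
    (hu : H.IsUniform k) (hconnected : H.IsConnected)
    (hH : HasHypercycleDegrees (edgeFamily H) k) : Function.Surjective f := by
  refine mem_of_isConnected hconnected (edge_nonempty_of_isUniform hk hu)
    ⟨f ⟨0, by lia⟩, Set.mem_range_self _⟩ ?_
  rintro _ ⟨i, rfl⟩ e v hvi hve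
  exact h.mem_range_of_mem hl hu hH hvi hve

end Recognition

section Isomorphism

variable [Finite H.vertexSet]

theorem exists_privateVertices (h : IsCyclicSequence u f) (hl : 2 ≤ l) (hu : H.IsUniform k)
    (hmeet : ∀ i j (v : H.vertexSet), i ≠ j → (v : β) ∈ (f i : Set β) → (v : β) ∈ (f j : Set β) →
      v = u i ∨ v = u (finRotate l i)) :
    ∃ w : Fin l → Fin (k - 2) → H.vertexSet, (∀ i, Function.Injective (w i)) ∧
      (∀ i p j, (w i p : β) ∈ (f j : Set β) ↔ i = j) ∧ ∀ i p j, w i p ≠ u j := by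
  let P (i : Fin l) : Set H.vertexSet := Subtype.val ⁻¹' (f i : Set β) \ {u i, u (finRotate l i)}
  have hcard (i : Fin l) : Nat.card (P i) = k - 2 := by
    rw [Nat.card_coe_set_eq, Set.ncard_sdiff, Set.ncard_pair, ← Set.ncard_image_of_injective _
      Subtype.val_injective, Subtype.image_preimage_coe, Set.inter_eq_right.2
      (subset_vertexSet_of_mem_edgeSet (f i).2), hu _ (f i).2]
    · exact fun hui => finRotate_ne hl i (h.vertex_injective hui).symm
    · exact Set.insert_subset (h.mem i) (Set.singleton_subset_iff.2 (h.finRotate_mem i))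
  let w (i : Fin l) : Fin (k - 2) ≃ P i := (Finite.equivFinOfCardEq (hcard i)).symm
  have hnot (i p) : (w i p : H.vertexSet) ≠ u i ∧ (w i p : H.vertexSet) ≠ u (finRotate l i) :=
    not_or.1 (w i p).2.2
  have hmem (i p j) : (w i p : β) ∈ (f j : Set β) ↔ i = j := by
    refine ⟨fun hj => ?_, by rintro rfl; exact (w i p).2.1⟩
    by_contra hij
    exact not_or.2 (hnot i p) (hmeet i j _ hij (w i p).2.1 hj)
  refine ⟨fun i p => w i p, fun i => Subtype.val_injective.comp (w i).injective, hmem, ?_⟩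
  intro i p j (hj : (w i p : H.vertexSet) = u j)
  obtain rfl := (hmem i p j).1 (by rw [hj]; exact h.mem j)
  exact (hnot i p).1 hj

theorem image_cycleEdge (h : IsCyclicSequence u f) (hk : 2 ≤ k) (hl : 2 ≤ l) (hu : H.IsUniform k)
    {w : Fin l → Fin (k - 2) → H.vertexSet} (hw : ∀ i p, (w i p : β) ∈ (f i : Set β))
    (hinjective : Function.Injective (Sum.elim u (Function.uncurry w))) (i : Fin l) :
    Subtype.val ∘ Sum.elim u (Function.uncurry w) ''
      (cycleEdge k l i : Set (Fin l ⊕ Fin l × Fin (k - 2))) = f i := by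
  have hfinite : (f i : Set β).Finite :=
    (Set.toFinite H.vertexSet).subset (subset_vertexSet_of_mem_edgeSet (f i).2)
  refine Set.eq_of_subset_of_ncard_le ?_ ?_ hfinite
  · rintro _ ⟨a | ⟨a, p⟩, hx, rfl⟩
    · obtain rfl | rfl := inl_mem_cycleEdge.1 hx
      exacts [h.mem _, h.finRotate_mem _]
    · obtain rfl := inr_mem_cycleEdge.1 hx
      exact hw _ _
  · rw [Set.ncard_image_of_injective _ (Subtype.val_injective.comp hinjective),
      Set.ncard_coe_finset, card_cycleEdge hk hl, hu _ (f i).2]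

end Isomorphism

end IsCyclicSequence

theorem isIsomorphic_hypercycle_of_equiv (ψ : Fin l ⊕ Fin l × Fin (k - 2) ≃ H.vertexSet)
    (hψ : (Set.range fun i => (fun x => (ψ x : β)) '' cycleEdge k l i) = H.edgeSet) :
    (hypercycle k l).IsIsomorphic H := by
  have hbijective : Function.Bijective fun x : (hypercycle k l).vertexSet => ψ x.1 :=
    ψ.bijective.comp ⟨Subtype.val_injective, fun x => ⟨⟨x, trivial⟩, rfl⟩⟩
  refine ⟨Equiv.ofBijective _ hbijective, fun e => ?_⟩
  have himage : Subtype.val '' (Equiv.ofBijective _ hbijective '' e) =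
      (fun x => (ψ x : β)) '' (Subtype.val '' e) := by
    rw [Set.image_image, Set.image_image]
    rfl
  have hinjective : Function.Injective fun x => (ψ x : β) :=
    Subtype.val_injective.comp ψ.injective
  rw [edgeSet_hypercycle, ← hψ]
  refine exists_congr fun i => ?_
  exact (Set.image_injective.2 hinjective).eq_iff.symm.trans (by rw [← himage])

theorem IsCyclicSequence.isIsomorphic_hypercycle [Fintype H.vertexSet]
    {u : Fin l → H.vertexSet} {f : Fin l → H.edgeSet} (h : IsCyclicSequence u f) (hk : 2 ≤ k)
    (hl : 2 ≤ l) (hu : H.IsUniform k) (hf : Function.Surjective f)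
    (hcard : Fintype.card H.vertexSet = l + l * (k - 2))
    (hmeet : ∀ i j (v : H.vertexSet), i ≠ j → (v : β) ∈ (f i : Set β) → (v : β) ∈ (f j : Set β) →
      v = u i ∨ v = u (finRotate l i)) :
    (hypercycle k l).IsIsomorphic H := by
  obtain ⟨w, hw, hmem, hne⟩ := h.exists_privateVertices hl hu hmeet
  have hinjective : Function.Injective (Sum.elim u (Function.uncurry w)) := by
    refine h.vertex_injective.sumElim ?_ fun j ip => (hne ip.1 ip.2 j).symm
    rintro ⟨i, p⟩ ⟨j, q⟩ hpq
    obtain rfl := (hmem i p j).1 (by rw [show w i p = w j q from hpq, hmem])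
    exact congrArg (Prod.mk i) (hw i hpq)
  have hbijective := (Fintype.bijective_iff_injective_and_card _).2 ⟨hinjective, by simp [hcard]⟩
  refine isIsomorphic_hypercycle_of_equiv (Equiv.ofBijective _ hbijective) ?_
  have himage := funext (h.image_cycleEdge hk hl hu (fun i p => (hmem i p i).2 rfl) hinjective)
  exact (congrArg Set.range himage).trans ((hf.range_comp Subtype.val).trans Subtype.range_coe)

end CyclicSequence

section UnicyclicHypergraph

open Hypergraph RTensor

variable {β : Type*} {H : Hypergraph β} {k m : ℕ} [Fintype H.vertexSet]

theorem card_vertexSet_of_isLinearUnicyclic (hk : 2 ≤ k) (h : H.IsLinearUnicyclic k m) :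
    Fintype.card H.vertexSet = m + m * (k - 2) := by
  have hcount := (isUnicyclic_iff (by lia : 1 ≤ k) h.uniform h.unicyclic.1).1 h.unicyclic
  rw [h.ncard_edgeSet, Nat.card_eq_fintype_card] at hcount
  obtain ⟨l, rfl⟩ : ∃ l, k = l + 2 := ⟨k - 2, by lia⟩
  rw [Nat.add_sub_cancel]
  linarith [hcount, mul_add m l 2]

theorem isIsomorphic_hypercycle_of_hasHypercycleDegrees [DecidableEq H.vertexSet] (hk : 2 ≤ k)
    (h : H.IsLinearUnicyclic k m) (hH : HasHypercycleDegrees (edgeFamily H) k) :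
    (hypercycle k m).IsIsomorphic H := by
  obtain ⟨_, ⟨x, c, hc, -⟩, -⟩ := h.unicyclic.2
  obtain ⟨l, u, f, hl, hcyclic⟩ := exists_isCyclicSequence hc
  have hsurjective := hcyclic.edge_surjective hl (by lia) h.uniform h.unicyclic.1 hH
  obtain rfl : l = m := by
    rw [← h.ncard_edgeSet, ← Nat.card_coe_set_eq,
      ← Nat.card_congr (Equiv.ofBijective f ⟨hcyclic.edge_injective, hsurjective⟩), Nat.card_fin]
  exact hcyclic.isIsomorphic_hypercycle hk hl h.uniform hsurjective
    (card_vertexSet_of_isLinearUnicyclic hk h) fun i j v hij =>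
      hcyclic.eq_or_eq_of_mem_of_mem hl h.uniform hH fun hf => hij (hcyclic.edge_injective hf)

end UnicyclicHypergraph

section MainTheorem

open Hypergraph RTensor

variable {β : Type*} {H : Hypergraph β} {k m : ℕ} {α : ℝ} [Fintype H.vertexSet]

theorem add_two_lt_mul_pow {k m n : ℕ} (hk : 3 ≤ k) (hm : 3 ≤ m) (hn : n = m + m * (k - 2)) :
    k + 2 < n * (k - 1) ^ (n - 1) := by
  obtain ⟨l, rfl⟩ : ∃ l, k = l + 3 := ⟨k - 3, by lia⟩
  have hle : 3 + 3 * (l + 1) ≤ n :=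
    hn ▸ Nat.add_le_add hm (Nat.mul_le_mul_right (l + 1) hm)
  calc l + 3 + 2 < n * 1 := by lia
    _ ≤ n * (l + 3 - 1) ^ (n - 1) := Nat.mul_le_mul_left _ (Nat.one_le_pow _ _ (by lia))

theorem exists_alphaMoment_hypercycle_lt [DecidableEq H.vertexSet] (hk : 3 ≤ k) (hm : 3 ≤ m)
    (hα₀ : 0 < α) (hα₁ : α < 1) (h : H.IsLinearUnicyclic k m)
    (hH : ¬HasHypercycleDegrees (edgeFamily H) k) :
    ∃ d ∈ Set.Icc 1 (k + 2),
      (∀ t < d, (hypercycle k m).alphaMoment k α t = H.alphaMoment k α t) ∧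
        (hypercycle k m).alphaMoment k α d < H.alphaMoment k α d := by
  classical
  have hC := isLinearUnicyclic_hypercycle hk hm
  let ψ : (hypercycle k m).vertexSet ≃ H.vertexSet := Fintype.equivOfCardEq <|
    card_vertexSet_hypercycle.trans (card_vertexSet_of_isLinearUnicyclic (by lia) h).symm
  let F := (edgeFamily (hypercycle k m)).map ψ.finsetCongr.toEmbedding
  have hmoment (t : ℕ) : (hypercycle k m).alphaMoment k α t = (familyTensor F k α).trace t := by
    rw [alphaMoment_eq_trace, ← trace_reindex ψ, familyTensor_comp ψ (mem_map_finsetCongr ψ)]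
  have hcard : F.card = (edgeFamily H).card := by
    rw [Finset.card_map, card_edgeFamily, card_edgeFamily, hC.ncard_edgeSet, h.ncard_edgeSet]
  have hne : H.edgeSet.Nonempty :=
    Set.nonempty_of_ncard_ne_zero (by rw [h.ncard_edgeSet]; lia)
  have hdegree (v : H.vertexSet) : 1 ≤ familyDegree (edgeFamily H) v := by
    rw [familyDegree_edgeFamily]
    exact one_le_degree h.unicyclic.1 hne (edge_nonempty_of_isUniform (by lia) h.uniform) v
  simp only [hmoment, alphaMoment_eq_trace (H := H)]
  exact ((hasHypercycleDegrees_hypercycle hk (by lia)).map ψ).exists_trace_lt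
    (isLinearUniform_edgeFamily h.uniform h.linear)
    ((isLinearUniform_edgeFamily hC.uniform hC.linear).map ψ) hk hα₀ hα₁ hcard hdegree hH

end MainTheorem

theorem mainTheorem11 (k m : ℕ) (hk : 3 ≤ k) (hm : 3 ≤ m) (α : ℝ) (hα₀ : 0 < α) (hα₁ : α < 1) :
    (Hypergraph.hypercycle k m).IsLinearUnicyclic k m ∧
      ∀ {β : Type*} (H : Hypergraph β) [Fintype H.vertexSet], H.IsLinearUnicyclic k m →
        Hypergraph.AlphaBeforeOrEq k α (Hypergraph.hypercycle k m) H ∧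
          (Hypergraph.AlphaEq k α (Hypergraph.hypercycle k m) H ↔
            (Hypergraph.hypercycle k m).IsIsomorphic H) := by
  have hC := isLinearUnicyclic_hypercycle hk hm
  refine ⟨hC, fun {β} H _ h => ?_⟩
  classical
  by_cases hH : RTensor.HasHypercycleDegrees (edgeFamily H) k
  · have hiso := isIsomorphic_hypercycle_of_hasHypercycleDegrees (by lia) h hH
    have heq := alphaEq_of_isIsomorphic hiso k α
    exact ⟨Or.inr heq, fun _ => hiso, fun _ => heq⟩
  · obtain ⟨d, ⟨hd, hdk⟩, hagree, hlt⟩ :=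
      exists_alphaMoment_hypercycle_lt hk hm hα₀ hα₁ h hH
    have hdlt := hdk.trans_lt (add_two_lt_mul_pow hk hm card_vertexSet_hypercycle)
    have hbefore : Hypergraph.AlphaBefore k α (Hypergraph.hypercycle k m) H :=
      ⟨card_vertexSet_hypercycle.trans (card_vertexSet_of_isLinearUnicyclic (by lia) h).symm,
        d, ⟨hd, Nat.le_sub_one_of_lt hdlt⟩, hagree, hlt⟩
    have hneq : ¬Hypergraph.AlphaEq k α (Hypergraph.hypercycle k m) H := fun heq =>
      hlt.ne (heq.2 d hdlt)
    exact ⟨Or.inl hbefore, fun heq => absurd heq hneq,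
      fun hiso => absurd (alphaEq_of_isIsomorphic hiso k α) hneq⟩
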